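/- Let $m\ge 0$, $a,b,c_1,\dots,c_m\in\mathbb C$. Let $D=\mathbb C\langle x_1,\dots,x_m,\partial_1,\dots,\partial_m\rangle$ be the Weyl algebra, $\theta_i=x_i\partial_i$, $\theta=\sum_i\theta_i$, and $$\ell_i=\theta_i(\theta_i+c_i-1)-x_i(\theta+a)(\theta+b)\quad(1\le i\le m),\qquad \ell_{ij}=x_j\ell_i-x_i\ell_j\quad(1\le i<j\le m).$$ A syzygy among these operators is a vector $(v_i,v_{ij})$ of elements of $D$ with $\sum_i v_i\ell_i+\sum_{i<j}v_{ij}\ell_{ij}=0$; the syzygies form a left $D$-module. Let $D^{(h)}=\mathbb C[h]\langle x_1,\dots,x_m,\partial_1,\dots,\partial_m\rangle$ be the homogenized Weyl algebra ($h$ is central, $\partial_ix_i=x_i\partial_i+h^2$, all other pairs of generators commute), and in $D^{(h)}$ put $\theta_i=x_i\partial_i$, $\theta=\sum_i\theta_i$, $S_i=\theta_i(\theta_i+(c_i-1)h^2)$, $S_{\alpha,\beta}=(\theta+\alpha h^2)(\theta+\beta h^2)$ for $\alpha,\beta\in\mathbb C$, and $$T_i=hS_i-x_iS_{a,b},\qquad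 T_{ij}=x_jS_i-x_iS_j,\qquad G=\{T_i\}_{1\le i\le m}\cup\{T_{ij}\}_{1\le i<j\le m}.$$ The substitution $h\mapsto1$ (dehomogenization) maps $D^{(h)}$ to $D$, $T_i$ to $\ell_i$ and $T_{ij}$ to $\ell_{ij}$. Order the normally ordered monomials $h^kx^\alpha\partial^\beta$ by total degree $k+|\alpha|+|\beta|$, then by the weight $-|\alpha|+|\beta|$, then lexicographically with $\partial_1\succ\cdots\succ\partial_m\succ x_1\succ\cdots\succ x_m$. For nonzero $f,g\in D^{(h)}$ with leading terms $f_e\,h^{k}x^{\alpha}\xi^{\beta}$ and $g_{e'}\,h^{k'}x^{\alpha'}\xi^{\beta'}$, let $h^\kappa x^\gamma\xi^\delta$ be the least common multiple of the two monomials; the S-pair is $$\mathrm{sp}(f,g)=g_{e'}h^{\kappa-k}x^{\gamma-\alpha}\partial^{\delta-\beta}f-f_{e}h^{\kappa-k'}x^{\gamma-\alpha'}\partial^{\delta-\beta'}g.$$ A standard representation of $f$ with respect to $G$ is an expression $f=\sum_{g\in G}r_gg$, $r_g\in D^{(h)}$, in which, for every $g$ with $r_g\ne0$, the leading monomial of $r_gg$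 does not exceed that of $f$ (for $f=0$: all $r_g=0$). A standard representation $\mathrm{sp}(p,q)=up-vq=\sum_g r_gg$ yields the relation $up-vq-\sum_gr_gg=0$ among the elements of $G$, and by $h\mapsto1$ a relation among the $\ell_i,\ell_{ij}$. Then the following hold. 1. The S-pair of any two distinct elements of $G$ has a standard representation with respect to $G$. 2. For any choice of standard representations of the S-pairs, one for each unordered pair of distinct elements of $G$ (in at least one of its two orders), the relations that they yield by $h\mapsto 1$ generate the left $D$-module of all syzygies among the $\ell_i$ $(1\le i\le m)$ and $\ell_{ij}$ $(1\le i<j\le m)$. 3. The same module of syzygies is generated by the relations obtained by $h\mapsto1$ from the following explicit expressions, where $T_{ji}=-T_{ij}$ for $i<j$, and distinct letters denote distinct indices: - $S_jT_i-S_iT_j=S_{a-1,b-1}T_{ij}$ $(i<j)$; - $x_jT_i-hT_{ij}=x_iT_j$ $(i<j)$; - $x_i^2\partial_i^2T_j-hx_j\partial_j^2T_{ij}=\{x_i\partial_j(\theta_j+(c_j-1)h^2)-c_ih^2\theta_i\}T_j-(2h^2\theta_j+c_jh^4)T_i-(S_{a-1,b-1}-c_jh^3\partial_j)T_{ij}$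 $(i<j)$; - $x_i^2x_j\partial_i^2T_k-hx_k^2\partial_k^2T_{ij}=hS_jT_{ki}+x_kS_iT_j-c_ih^2x_j\theta_iT_k+c_kh^3\theta_kT_{ij}$ $(i<j)$; - $x_kT_{ij}-x_jT_{ik}=-x_iT_{jk}$ $(i<j,\ i<k)$; - $x_k^2\partial_k^2T_{ij}-x_i^2\partial_i^2T_{kj}=S_jT_{ik}-c_kh^2\theta_kT_{ij}+c_ih^2\theta_iT_{kj}$ $(i<j,\ k<j)$; - $x_jx_k\partial_j^2T_{ij}-x_i^2\partial_i^2T_{jk}=\{S_k+(2-c_j)h^2x_k\partial_j\}T_{ij}+(c_j-2)h^4T_{ik}+\{(2-c_j)h^2x_i\partial_j+c_ih^2\theta_i-x_i\theta_j\partial_j\}T_{jk}$ $(i<j<k)$; - $x_k^2x_l\partial_k^2T_{ij}-x_i^2x_j\partial_i^2T_{kl}=x_lS_jT_{ik}-x_kS_iT_{jl}-c_kh^2x_l\theta_kT_{ij}+c_ih^2x_j\theta_iT_{kl}$ $(i<j,\ k<l)$. 4. For example, for $i<j$ the expression $x_iT_j$ is a standard representation of $\mathrm{sp}(T_i,T_{ij})$,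 and the relation it yields is the syzygy $x_j\ell_i-\ell_{ij}-x_i\ell_j=0$. -/

import Mathlib

open scoped BigOperators

namespace LauricellaFC

/-! ### The Weyl algebra -/

/-- The generators `x_1, …, x_m, ∂_1, …, ∂_m` of the Weyl algebra. -/
inductive WGen (m : ℕ) : Type
  | x (i : Fin m) : WGen m
  | d (i : Fin m) : WGen m

/-- The defining relations of the Weyl algebra:
`x_i x_j = x_j x_i`, `∂_i ∂_j = ∂_j ∂_i`, `∂_i x_j = x_j ∂_i` for `i ≠ j`, `∂_i x_i = x_i ∂_i + 1`. -/
inductive WRel (m : ℕ) : FreeAlgebra ℂ (WGen m) → FreeAlgebra ℂ (WGen m) → Prop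
  | x_comm (i j : Fin m) : WRel m
      (FreeAlgebra.ι ℂ (.x i) * FreeAlgebra.ι ℂ (.x j))
      (FreeAlgebra.ι ℂ (.x j) * FreeAlgebra.ι ℂ (.x i))
  | d_comm (i j : Fin m) : WRel m
      (FreeAlgebra.ι ℂ (.d i) * FreeAlgebra.ι ℂ (.d j))
      (FreeAlgebra.ι ℂ (.d j) * FreeAlgebra.ι ℂ (.d i))
  | d_x_ne (i j : Fin m) (hij : i ≠ j) : WRel m
      (FreeAlgebra.ι ℂ (.d i) * FreeAlgebra.ι ℂ (.x j))
      (FreeAlgebra.ι ℂ (.x j) * FreeAlgebra.ι ℂ (.d i))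
  | d_x_eq (i : Fin m) : WRel m
      (FreeAlgebra.ι ℂ (.d i) * FreeAlgebra.ι ℂ (.x i))
      (FreeAlgebra.ι ℂ (.x i) * FreeAlgebra.ι ℂ (.d i) + 1)

/-- The Weyl algebra `D = ℂ⟨x_1, …, x_m, ∂_1, …, ∂_m⟩`. -/
def Weyl (m : ℕ) : Type := RingQuot (WRel m)

noncomputable instance (m : ℕ) : Ring (Weyl m) := inferInstanceAs (Ring (RingQuot (WRel m)))

noncomputable instance (m : ℕ) : Algebra ℂ (Weyl m) :=
  inferInstanceAs (Algebra ℂ (RingQuot (WRel m)))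

namespace Weyl

variable {m : ℕ}

/-- The canonical projection from the free algebra. -/
noncomputable def mk (m : ℕ) : FreeAlgebra ℂ (WGen m) →ₐ[ℂ] Weyl m :=
  RingQuot.mkAlgHom ℂ (WRel m)

theorem mk_rel {p q : FreeAlgebra ℂ (WGen m)} (hpq : WRel m p q) : mk m p = mk m q :=
  RingQuot.mkAlgHom_rel ℂ hpq

/-- The element `x_i` of `D`. -/
noncomputable def x (i : Fin m) : Weyl m := mk m (FreeAlgebra.ι ℂ (.x i))

/-- The element `∂_i` of `D`. -/
noncomputable def d (i : Fin m) : Weyl m := mk m (FreeAlgebra.ι ℂ (.d i))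

/-- The Euler operator `θ_i = x_i ∂_i`. -/
noncomputable def theta (i : Fin m) : Weyl m := x i * d i

/-- `θ = θ_1 + ⋯ + θ_m`. -/
noncomputable def thetaSum (m : ℕ) : Weyl m := ∑ i, theta i

theorem x_mul_x (i j : Fin m) : (x i * x j : Weyl m) = x j * x i := by
  simpa [x, d] using mk_rel (WRel.x_comm i j)

theorem d_mul_d (i j : Fin m) : (d i * d j : Weyl m) = d j * d i := by
  simpa [x, d] using mk_rel (WRel.d_comm i j)

theorem d_mul_x_ne (i j : Fin m) (hij : i ≠ j) : (d i * x j : Weyl m) = x j * d i := by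
  simpa [x, d] using mk_rel (WRel.d_x_ne i j hij)

theorem d_mul_x_eq (i : Fin m) : (d i * x i : Weyl m) = x i * d i + 1 := by
  simpa [x, d] using mk_rel (WRel.d_x_eq i)

end Weyl

/-! ### The homogenized Weyl algebra -/

/-- The generators `h, x_1, …, x_m, ∂_1, …, ∂_m` of the homogenized Weyl algebra. -/
inductive HGen (m : ℕ) : Type
  | h : HGen m
  | x (i : Fin m) : HGen m
  | d (i : Fin m) : HGen m

/-- The defining relations of the homogenized Weyl algebra: those of the Weyl algebra, except that
`h` commutes with everything and `∂_i x_i = x_i ∂_i + h²`. -/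
inductive HRel (m : ℕ) : FreeAlgebra ℂ (HGen m) → FreeAlgebra ℂ (HGen m) → Prop
  | h_comm (g : HGen m) : HRel m
      (FreeAlgebra.ι ℂ .h * FreeAlgebra.ι ℂ g)
      (FreeAlgebra.ι ℂ g * FreeAlgebra.ι ℂ .h)
  | x_comm (i j : Fin m) : HRel m
      (FreeAlgebra.ι ℂ (.x i) * FreeAlgebra.ι ℂ (.x j))
      (FreeAlgebra.ι ℂ (.x j) * FreeAlgebra.ι ℂ (.x i))
  | d_comm (i j : Fin m) : HRel m
      (FreeAlgebra.ι ℂ (.d i) * FreeAlgebra.ι ℂ (.d j))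
      (FreeAlgebra.ι ℂ (.d j) * FreeAlgebra.ι ℂ (.d i))
  | d_x_ne (i j : Fin m) (hij : i ≠ j) : HRel m
      (FreeAlgebra.ι ℂ (.d i) * FreeAlgebra.ι ℂ (.x j))
      (FreeAlgebra.ι ℂ (.x j) * FreeAlgebra.ι ℂ (.d i))
  | d_x_eq (i : Fin m) : HRel m
      (FreeAlgebra.ι ℂ (.d i) * FreeAlgebra.ι ℂ (.x i))
      (FreeAlgebra.ι ℂ (.x i) * FreeAlgebra.ι ℂ (.d i) + FreeAlgebra.ι ℂ .h ^ 2)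

/-- The homogenized Weyl algebra `D^(h) = ℂ[h]⟨x_1, …, x_m, ∂_1, …, ∂_m⟩`. -/
def HWeyl (m : ℕ) : Type := RingQuot (HRel m)

noncomputable instance (m : ℕ) : Ring (HWeyl m) := inferInstanceAs (Ring (RingQuot (HRel m)))

noncomputable instance (m : ℕ) : Algebra ℂ (HWeyl m) :=
  inferInstanceAs (Algebra ℂ (RingQuot (HRel m)))

namespace HWeyl

variable {m : ℕ}

/-- The canonical projection from the free algebra. -/
noncomputable def mk (m : ℕ) : FreeAlgebra ℂ (HGen m) →ₐ[ℂ] HWeyl m :=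
  RingQuot.mkAlgHom ℂ (HRel m)

theorem mk_rel {p q : FreeAlgebra ℂ (HGen m)} (hpq : HRel m p q) : mk m p = mk m q :=
  RingQuot.mkAlgHom_rel ℂ hpq

/-- The homogenization variable `h`. -/
noncomputable def h : HWeyl m := mk m (FreeAlgebra.ι ℂ .h)

/-- The element `x_i` of `D^(h)`. -/
noncomputable def x (i : Fin m) : HWeyl m := mk m (FreeAlgebra.ι ℂ (.x i))

/-- The element `∂_i` of `D^(h)`. -/
noncomputable def d (i : Fin m) : HWeyl m := mk m (FreeAlgebra.ι ℂ (.d i))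

/-- The Euler operator `θ_i = x_i ∂_i`. -/
noncomputable def theta (i : Fin m) : HWeyl m := x i * d i

/-- `θ = θ_1 + ⋯ + θ_m`. -/
noncomputable def thetaSum (m : ℕ) : HWeyl m := ∑ i, theta i

/-- A homomorphism out of `D^(h)`, given by images of the generators satisfying the relations. -/
noncomputable def lift {A : Type*} [Ring A] [Algebra ℂ A] (f : HGen m → A)
    (hf : ∀ p q, HRel m p q → FreeAlgebra.lift ℂ f p = FreeAlgebra.lift ℂ f q) :
    HWeyl m →ₐ[ℂ] A :=
  RingQuot.liftAlgHom ℂ ⟨FreeAlgebra.lift ℂ f, fun {p q} hpq => hf p q hpq⟩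

theorem lift_mk_ι {A : Type*} [Ring A] [Algebra ℂ A] (f : HGen m → A)
    (hf : ∀ p q, HRel m p q → FreeAlgebra.lift ℂ f p = FreeAlgebra.lift ℂ f q) (g : HGen m) :
    lift f hf (mk m (FreeAlgebra.ι ℂ g)) = f g := by
  have := RingQuot.liftAlgHom_mkAlgHom_apply ℂ (FreeAlgebra.lift ℂ f)
    (fun {p q} hpq => hf p q hpq) (FreeAlgebra.ι ℂ g) (s := HRel m)
  rw [FreeAlgebra.lift_ι_apply] at this
  exact this

/-- Images of the generators under dehomogenization. -/
noncomputable def dehomGen : HGen m → Weyl m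
  | .h => 1
  | .x i => Weyl.x i
  | .d i => Weyl.d i

/-- Dehomogenization `D^(h) → D`: the algebra homomorphism
`h ↦ 1`, `x_i ↦ x_i`, `∂_i ↦ ∂_i`. -/
noncomputable def dehom (m : ℕ) : HWeyl m →ₐ[ℂ] Weyl m :=
  lift dehomGen (by
    intro p q hpq
    cases hpq with
    | h_comm g => simp [dehomGen]
    | x_comm i j => simpa [dehomGen] using Weyl.x_mul_x i j
    | d_comm i j => simpa [dehomGen] using Weyl.d_mul_d i j
    | d_x_ne i j hij => simpa [dehomGen] using Weyl.d_mul_x_ne i j hij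
    | d_x_eq i => simpa [dehomGen] using Weyl.d_mul_x_eq i)

/-! ### Normally ordered expressions and total symbols -/

/-- The monomial `h^k x^α ∂^β` of `D^(h)` with exponent vector `e = (k, α, β)`. -/
noncomputable def mono (e : HGen m →₀ ℕ) : HWeyl m :=
  h ^ e .h * ((List.finRange m).map fun i => x i ^ e (.x i)).prod
    * ((List.finRange m).map fun i => d i ^ e (.d i)).prod

/-- The action of the generators of `D^(h)` on the commutative polynomial ring
`ℂ[h, x_1, …, x_m, ξ_1, …, ξ_m]` (`ξ_i` is the variable with index `HGen.d i`), which is left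
multiplication in `D^(h)` written in terms of normally ordered expressions:
`h` and `x_i` act by multiplication, and `∂_i` acts as `ξ_i + h² ∂/∂x_i`. -/
noncomputable def symbolGen : HGen m → Module.End ℂ (MvPolynomial (HGen m) ℂ)
  | .h => LinearMap.mulLeft ℂ (MvPolynomial.X .h)
  | .x i => LinearMap.mulLeft ℂ (MvPolynomial.X (.x i))
  | .d i => LinearMap.mulLeft ℂ (MvPolynomial.X (.d i)) +
      LinearMap.mulLeft ℂ (MvPolynomial.X .h ^ 2) *
        (MvPolynomial.pderiv (R := ℂ) (HGen.x i)).toLinearMap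

theorem pderiv_comm {σ : Type*} (i j : σ) (f : MvPolynomial σ ℂ) :
    MvPolynomial.pderiv i (MvPolynomial.pderiv j f)
      = MvPolynomial.pderiv j (MvPolynomial.pderiv i f) := by
  classical
  have hz : ⁅MvPolynomial.pderiv (R := ℂ) i, MvPolynomial.pderiv (R := ℂ) j⁆ = 0 := by
    refine MvPolynomial.derivation_ext fun k => ?_
    rw [Derivation.commutator_apply]
    by_cases hi : k = i <;> by_cases hj : k = j <;>
      simp [MvPolynomial.pderiv_X, Pi.single_apply, hi, hj, apply_ite]
  have := congrArg (fun D => D f) hz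
  rw [Derivation.commutator_apply] at this
  exact sub_eq_zero.mp this

/-- The action of `D^(h)` on `ℂ[h, x, ξ]` by left multiplication of normally ordered
expressions. -/
noncomputable def symbolAct (m : ℕ) : HWeyl m →ₐ[ℂ] Module.End ℂ (MvPolynomial (HGen m) ℂ) :=
  lift symbolGen (by
    classical
    intro p q hpq
    cases hpq with
    | h_comm g =>
      cases g <;> refine LinearMap.ext fun f => ?_ <;>
        simp [symbolGen, Derivation.leibniz] <;> ring
    | x_comm i j =>
      refine LinearMap.ext fun f => ?_
      simp [symbolGen]; ring
    | d_comm i j =>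
      refine LinearMap.ext fun f => ?_
      have hc := pderiv_comm (HGen.x i) (HGen.x j) f
      simp [symbolGen, Derivation.leibniz, MvPolynomial.pderiv_X, hc]; ring
    | d_x_ne i j hij =>
      refine LinearMap.ext fun f => ?_
      simp [symbolGen, Derivation.leibniz, MvPolynomial.pderiv_X, hij.symm]
      ring
    | d_x_eq i =>
      refine LinearMap.ext fun f => ?_
      simp [symbolGen, Derivation.leibniz, MvPolynomial.pderiv_X]
      ring)

/-- The total symbol of an element of `D^(h)`: the symbol of the (unique) normally ordered
expression `∑ c_{kαβ} h^k x^α ∂^β` is the commutative polynomial `∑ c_{kαβ} h^k x^α ξ^β`.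
It is computed by letting the operator act on `1`; see `symbol_mono`. -/
noncomputable def symbol (m : ℕ) : HWeyl m →ₗ[ℂ] MvPolynomial (HGen m) ℂ :=
  (LinearMap.applyₗ (1 : MvPolynomial (HGen m) ℂ)) ∘ₗ (symbolAct m).toLinearMap

theorem symbol_mono (e : HGen m →₀ ℕ) : symbol m (mono e) = MvPolynomial.monomial e 1 := by
  classical
  have hh : symbolAct m h = symbolGen .h := lift_mk_ι _ _ _
  have hx : ∀ i : Fin m, symbolAct m (x i) = symbolGen (.x i) := fun i => lift_mk_ι _ _ _
  have hd : ∀ i : Fin m, symbolAct m (d i) = symbolGen (.d i) := fun i => lift_mk_ι _ _ _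
  have hdpow : ∀ (i : Fin m) (n : ℕ) (q : MvPolynomial (HGen m) ℂ),
      MvPolynomial.pderiv (HGen.x i) q = 0 →
      ((symbolGen (.d i)) ^ n : Module.End ℂ _) q = MvPolynomial.X (.d i) ^ n * q := by
    intro i n q hq
    induction n with
    | zero => simp
    | succ n ih =>
      rw [pow_succ', Module.End.mul_apply, ih]
      simp [symbolGen, Derivation.leibniz, Derivation.leibniz_pow, hq, MvPolynomial.pderiv_X]
      ring
  have hdprod : ∀ l : List (Fin m),
      symbolAct m ((l.map fun i => d i ^ e (.d i)).prod) 1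
        = (l.map fun i => (MvPolynomial.X (.d i) : MvPolynomial (HGen m) ℂ) ^ e (.d i)).prod
      ∧ ∀ j : Fin m, MvPolynomial.pderiv (HGen.x j)
        (l.map fun i => (MvPolynomial.X (.d i) : MvPolynomial (HGen m) ℂ) ^ e (.d i)).prod = 0 := by
    intro l
    induction l with
    | nil => simp
    | cons i l ih =>
      refine ⟨?_, fun j => ?_⟩
      · simp only [List.map_cons, List.prod_cons, map_mul, map_pow, Module.End.mul_apply, ih.1, hd]
        exact hdpow _ _ _ (ih.2 i)
      · simp only [List.map_cons, List.prod_cons, Derivation.leibniz, ih.2 j]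
        simp [Derivation.leibniz_pow, MvPolynomial.pderiv_X]
  have hxprod : ∀ (l : List (Fin m)) (q : MvPolynomial (HGen m) ℂ),
      symbolAct m ((l.map fun i => x i ^ e (.x i)).prod) q
        = (l.map fun i => (MvPolynomial.X (.x i) : MvPolynomial (HGen m) ℂ) ^ e (.x i)).prod * q := by
    intro l
    induction l with
    | nil => simp
    | cons i l ih =>
      intro q
      simp only [List.map_cons, List.prod_cons, map_mul, map_pow, Module.End.mul_apply, ih, hx]
      simp [symbolGen, LinearMap.pow_mulLeft, mul_assoc]
  have hmono : (MvPolynomial.monomial e (1 : ℂ))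
      = MvPolynomial.X .h ^ e .h
        * (((List.finRange m).map fun i => (MvPolynomial.X (.x i)) ^ e (.x i)).prod
          * ((List.finRange m).map fun i => (MvPolynomial.X (.d i)) ^ e (.d i)).prod) := by
    have he : e = Finsupp.single .h (e .h) + ((∑ i : Fin m, Finsupp.single (.x i) (e (.x i)))
        + ∑ i : Fin m, Finsupp.single (.d i) (e (.d i))) := by
      ext g
      cases g <;> simp [Finsupp.single_apply]
    rw [← List.ofFn_eq_map, ← List.ofFn_eq_map, List.prod_ofFn, List.prod_ofFn]
    conv_lhs => rw [he]
    simp only [MvPolynomial.X_pow_eq_monomial, ← MvPolynomial.monomial_sum_one,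
      MvPolynomial.monomial_mul, mul_one]
  rw [hmono, symbol]
  simp [mono, hdprod, hxprod, hh, symbolGen, LinearMap.pow_mulLeft]

/-! ### The monomial order, S-pairs and standard representations -/

/-- The type of comparison keys of monomials: total degree, then weight, then the exponents of
`∂_1, …, ∂_m`, then the exponents of `x_1, …, x_m`, compared lexicographically. -/
abbrev Key (m : ℕ) : Type := ℕ ×ₗ (ℤ ×ₗ (Lex (Fin m → ℕ) ×ₗ Lex (Fin m → ℕ)))

/-- The comparison key of the monomial `h^k x^α ∂^β`. Monomials are compared first by total degree
`k + |α| + |β|`, then by the weight `-|α| + |β|`, and then lexicographically with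
`∂_1 ≻ ⋯ ≻ ∂_m ≻ x_1 ≻ ⋯ ≻ x_m`. -/
def key (e : HGen m →₀ ℕ) : Key m :=
  toLex (e .h + ∑ i : Fin m, e (.x i) + ∑ i : Fin m, e (.d i),
    toLex ((∑ i : Fin m, (e (.d i) : ℤ)) - ∑ i : Fin m, (e (.x i) : ℤ),
      toLex (toLex fun i => e (.d i), toLex fun i => e (.x i))))

/-- The key of the leading monomial of `f`, and `⊥` for `f = 0`. Two elements are compared with
respect to the order by comparing their leading keys. -/
noncomputable def leadKey (f : HWeyl m) : WithBot (Key m) :=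
  (symbol m f).support.sup fun e => (key e : WithBot (Key m))

open Classical in
/-- The exponent vector of the leading monomial of `f` (and `0` for `f = 0`). -/
noncomputable def leadExp (f : HWeyl m) : HGen m →₀ ℕ :=
  if hf : ∃ e ∈ (symbol m f).support, (key e : WithBot (Key m)) = leadKey f then hf.choose else 0

/-- The coefficient of the leading monomial of `f`. -/
noncomputable def leadCoeff (f : HWeyl m) : ℂ := (symbol m f).coeff (leadExp f)

/-- The left multiplier of `f` in the S-pair of `f` and `g`: the leading coefficient of `g` times
the monomial `lcm(in f, in g) / in f`. -/
noncomputable def sMult (f g : HWeyl m) : HWeyl m :=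
  leadCoeff g • mono (leadExp f ⊔ leadExp g - leadExp f)

/-- The S-pair `sp(f, g)`. -/
noncomputable def sPair (f g : HWeyl m) : HWeyl m := sMult f g * f - sMult g f * g

/-- `f = ∑ r_k g_k` is a standard representation of `f` with respect to the family `g`: no leading
monomial of a summand `r_k g_k` with `r_k ≠ 0` exceeds that of `f`. -/
def IsStandardRep {ι : Type*} [Fintype ι] (g : ι → HWeyl m) (f : HWeyl m) (r : ι → HWeyl m) :
    Prop :=
  f = ∑ k, r k * g k ∧ ∀ k, r k ≠ 0 → leadKey (r k * g k) ≤ leadKey f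

/-- The relation `sp(g_p, g_q) - ∑ r_k g_k = 0` as a vector of coefficients of the `g_k`. -/
noncomputable def sPairRelation {ι : Type*} [DecidableEq ι] (g : ι → HWeyl m) (p q : ι)
    (r : ι → HWeyl m) : ι → HWeyl m :=
  Pi.single p (sMult (g p) (g q)) - Pi.single q (sMult (g q) (g p)) - r

/-- Entrywise dehomogenization of a vector of coefficients. -/
noncomputable def dehomVec {ι : Type*} (v : ι → HWeyl m) : ι → Weyl m := fun k => dehom m (v k)

end HWeyl

/-! ### The operators -/

/-- Indices of the generators: `i` for `ℓ_i`, and pairs `i < j` for `ℓ_{ij}`. -/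
abbrev Idx (m : ℕ) : Type := Fin m ⊕ {p : Fin m × Fin m // p.1 < p.2}

section Operators

variable {m : ℕ}

/-- `ℓ_i = θ_i (θ_i + c_i - 1) - x_i (θ + a) (θ + b)`. -/
noncomputable def ell (a b : ℂ) (c : Fin m → ℂ) (i : Fin m) : Weyl m :=
  Weyl.theta i * (Weyl.theta i + algebraMap ℂ (Weyl m) (c i - 1))
    - Weyl.x i * (Weyl.thetaSum m + algebraMap ℂ (Weyl m) a)
      * (Weyl.thetaSum m + algebraMap ℂ (Weyl m) b)

/-- `ℓ_{ij} = x_j ℓ_i - x_i ℓ_j`. -/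
noncomputable def ell₂ (a b : ℂ) (c : Fin m → ℂ) (i j : Fin m) : Weyl m :=
  Weyl.x j * ell a b c i - Weyl.x i * ell a b c j

/-- The family of the `ℓ_i` and the `ℓ_{ij}`, `i < j`. -/
noncomputable def ellFamily (a b : ℂ) (c : Fin m → ℂ) : Idx m → Weyl m
  | .inl i => ell a b c i
  | .inr p => ell₂ a b c p.1.1 p.1.2

/-- The left `D`-module of syzygies of a finite family: all `(v_k)` with `∑ v_k g_k = 0`. -/
noncomputable def syzygies {ι : Type*} [Fintype ι] (g : ι → Weyl m) :
    Submodule (Weyl m) (ι → Weyl m) where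
  carrier := {v | ∑ k, v k * g k = 0}
  add_mem' := by
    intro v w hv hw
    simp only [Set.mem_ofPred_eq, Pi.add_apply, add_mul, Finset.sum_add_distrib] at *
    rw [hv, hw, add_zero]
  zero_mem' := by simp
  smul_mem' := by
    intro r v hv
    simp only [Set.mem_ofPred_eq, Pi.smul_apply, smul_eq_mul, mul_assoc, ← Finset.mul_sum] at *
    rw [hv, mul_zero]

open HWeyl

/-- `S_i = θ_i (θ_i + (c_i - 1) h²)`. -/
noncomputable def opS (c : Fin m → ℂ) (i : Fin m) : HWeyl m :=
  theta i * (theta i + (c i - 1) • h ^ 2)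

/-- `S_{ab} = (θ + a h²) (θ + b h²)`. -/
noncomputable def opSab (m : ℕ) (a b : ℂ) : HWeyl m :=
  (thetaSum m + a • h ^ 2) * (thetaSum m + b • h ^ 2)

/-- `T_i = h S_i - x_i S_{ab}`. -/
noncomputable def opT (a b : ℂ) (c : Fin m → ℂ) (i : Fin m) : HWeyl m :=
  h * opS c i - x i * opSab m a b

/-- `T_{ij} = x_j S_i - x_i S_j`. -/
noncomputable def opT₂ (c : Fin m → ℂ) (i j : Fin m) : HWeyl m :=
  x j * opS c i - x i * opS c j

/-- The family `G` of the `T_i` and the `T_{ij}`, `i < j`. -/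
noncomputable def opG (a b : ℂ) (c : Fin m → ℂ) : Idx m → HWeyl m
  | .inl i => opT a b c i
  | .inr p => opT₂ c p.1.1 p.1.2

/-- The unit vector that stands for `T_i`. -/
noncomputable def unitT (i : Fin m) : Idx m → HWeyl m := Pi.single (.inl i) 1

/-- The vector that stands for `T_{ij}`, with the convention `T_{ji} = -T_{ij}`. -/
noncomputable def unitT₂ (i j : Fin m) : Idx m → HWeyl m :=
  if hij : i < j then Pi.single (.inr ⟨(i, j), hij⟩) 1
  else if hji : j < i then -Pi.single (.inr ⟨(j, i), hji⟩) 1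
  else 0

/-- The explicit relations among the `T_i` and `T_{ij}` that express the S-pairs of the various
types; each constructor lists the relation `(combination of the two elements) - (right side)`. -/
inductive ExplicitRelation (a b : ℂ) (c : Fin m → ℂ) : (Idx m → HWeyl m) → Prop
  | T_T (i j : Fin m) (hij : i < j) : ExplicitRelation a b c
      (opS c j • unitT i - opS c i • unitT j - opSab m (a - 1) (b - 1) • unitT₂ i j)
  | Ti_Tij (i j : Fin m) (hij : i < j) : ExplicitRelation a b c
      (x j • unitT i - h (m := m) • unitT₂ i j - x i • unitT j)
  | Tj_Tij (i j : Fin m) (hij : i < j) : ExplicitRelation a b c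
      ((x i ^ 2 * d i ^ 2) • unitT j - (h * x j * d j ^ 2) • unitT₂ i j
        - ((x i * (d j * (theta j + (c j - 1) • h ^ 2)) - c i • (h ^ 2 * theta i)) • unitT j
          - ((2 : ℂ) • (h ^ 2 * theta j) + c j • h ^ 4) • unitT i
          - (opSab m (a - 1) (b - 1) - c j • (h ^ 3 * d j)) • unitT₂ i j))
  | Tk_Tij (i j k : Fin m) (hij : i < j) (hik : i ≠ k) (hjk : j ≠ k) : ExplicitRelation a b c
      ((x i ^ 2 * x j * d i ^ 2) • unitT k - (h * x k ^ 2 * d k ^ 2) • unitT₂ i j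
        - ((h * opS c j) • unitT₂ k i + (x k * opS c i) • unitT j
          - (c i • (h ^ 2 * x j * theta i)) • unitT k + (c k • (h ^ 3 * theta k)) • unitT₂ i j))
  | Tij_Tik (i j k : Fin m) (hij : i < j) (hik : i < k) (hjk : j ≠ k) : ExplicitRelation a b c
      (x k • unitT₂ i j - x j • unitT₂ i k - (-x i) • unitT₂ j k)
  | Tij_Tkj (i j k : Fin m) (hij : i < j) (hkj : k < j) (hik : i ≠ k) : ExplicitRelation a b c
      ((x k ^ 2 * d k ^ 2) • unitT₂ i j - (x i ^ 2 * d i ^ 2) • unitT₂ k j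
        - (opS c j • unitT₂ i k - (c k • (h ^ 2 * theta k)) • unitT₂ i j
          + (c i • (h ^ 2 * theta i)) • unitT₂ k j))
  | Tij_Tjk (i j k : Fin m) (hij : i < j) (hjk : j < k) : ExplicitRelation a b c
      ((x j * x k * d j ^ 2) • unitT₂ i j - (x i ^ 2 * d i ^ 2) • unitT₂ j k
        - ((opS c k + (2 - c j) • (h ^ 2 * x k * d j)) • unitT₂ i j
          + ((c j - 2) • h (m := m) ^ 4) • unitT₂ i k
          + ((2 - c j) • (h ^ 2 * x i * d j) + c i • (h ^ 2 * theta i)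
              - x i * theta j * d j) • unitT₂ j k))
  | Tij_Tkl (i j k l : Fin m) (hij : i < j) (hkl : k < l) (hik : i ≠ k) (hil : i ≠ l)
      (hjk : j ≠ k) (hjl : j ≠ l) : ExplicitRelation a b c
      ((x k ^ 2 * x l * d k ^ 2) • unitT₂ i j - (x i ^ 2 * x j * d i ^ 2) • unitT₂ k l
        - ((x l * opS c j) • unitT₂ i k - (x k * opS c i) • unitT₂ j l
          - (c k • (h ^ 2 * x l * theta k)) • unitT₂ i j
          + (c i • (h ^ 2 * x j * theta i)) • unitT₂ k l))

end Operators

end LauricellaFC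

namespace LauricellaFC

namespace HWeyl

variable {m : ℕ}

/-! ### Commutation rules in the homogenized Weyl algebra -/

/-! The argument is that of Buchberger and Schreyer in $D^{(h)}$, followed by $h\mapsto 1$. The
action of $D^{(h)}$ on symbols shows that the monomials $h^kx^\alpha\partial^\beta$ form a basis.
Commuting $\partial_i$ past $x_i$ replaces $x_i\partial_i$ by $h^2$, which has the same degree and
weight but is lexicographically smaller. Hence leading terms multiply (`IsTop.mul`), and the order
is a well-order (`wellFounded_key`).

Call a relation $\sum_k w_kg_k=0$ critical for $(p,q)$ if exactly the summands of $p$ and $q$ reach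
the least common multiple of the two leading monomials (`IsCritical`). If a module $N$ of relations
contains a critical relation for every pair, then cancelling top terms pairwise rewrites any
combination of the $g_k$, modulo $N$, so that no summand exceeds the value (`exists_reduced`).
Applied to an S-pair this gives a standard representation; applied to a combination with value zero
it shows that $N$ contains every relation. The relation from a standard representation of an S-pair
is itself critical (`isCritical_sPairRelation`).

For $G$ the leading monomials are $hx_i^2\partial_i^2$ and $x_jx_i^2\partial_i^2$ with $i<j$. The
$T_{ij}$ are the $2\times 2$ minors of the array with rows $x$ and $S$, and the required relations
are essentially identities of minors. Four of the explicit families provide critical relations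
directly: $(T_i,T_j)$, $(T_i,T_{ij})$, $(T_{ij},T_{ik})$ and $(T_{ij},T_{kj})$. The chain criterion
supplies every other pair (`hasCritical`), so of the other four families only their validity is
needed.

For the passage to $D$, homogeneity is expressed by the maps $h\mapsto\tau$, $x_i\mapsto\tau x_i$,
$\partial_i\mapsto\tau\partial_i$, which are jointly injective (`eq_zero_of_dehomAt`). All members
of $G$ have degree 5, so a syzygy in $D$ lifts, with entries of one common degree, to a relation in
$D^{(h)}$ (`span_dehomVec_eq_syzygies`). -/

theorem h_commute_gen (g : HGen m) : Commute (h : HWeyl m) (mk m (FreeAlgebra.ι ℂ g)) := by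
  simpa [h, Commute, SemiconjBy] using mk_rel (HRel.h_comm g)

/-- Induction over the generators of `D^(h)`. -/
theorem induction {C : HWeyl m → Prop} (algebraMap : ∀ r : ℂ, C (algebraMap ℂ (HWeyl m) r))
    (h : C h) (x : ∀ i, C (x i)) (d : ∀ i, C (d i))
    (mul : ∀ f g, C f → C g → C (f * g)) (add : ∀ f g, C f → C g → C (f + g))
    (f : HWeyl m) : C f := by
  obtain ⟨p, rfl⟩ := RingQuot.mkAlgHom_surjective ℂ (HRel m) f
  change C (mk m p)
  induction p using FreeAlgebra.induction with
  | grade0 r => rw [AlgHom.commutes]; exact algebraMap r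
  | grade1 g => cases g with
    | h => exact h
    | x i => exact x i
    | d i => exact d i
  | mul a b ha hb => rw [map_mul]; exact mul _ _ ha hb
  | add a b ha hb => rw [map_add]; exact add _ _ ha hb

theorem h_commute (f : HWeyl m) : Commute h f := by
  induction f using HWeyl.induction with
  | algebraMap r => exact (Algebra.commutes r h).symm
  | h => exact Commute.refl _
  | x i => exact h_commute_gen (.x i)
  | d i => exact h_commute_gen (.d i)
  | mul f g hf hg => exact hf.mul_right hg
  | add f g hf hg => exact hf.add_right hg

theorem x_commute (i j : Fin m) : Commute (x i : HWeyl m) (x j) := by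
  simpa [x, Commute, SemiconjBy] using mk_rel (HRel.x_comm i j)

theorem d_commute (i j : Fin m) : Commute (d i : HWeyl m) (d j) := by
  simpa [d, Commute, SemiconjBy] using mk_rel (HRel.d_comm i j)

theorem d_commute_x {i j : Fin m} (hij : i ≠ j) : Commute (d i : HWeyl m) (x j) := by
  simpa [x, d, Commute, SemiconjBy] using mk_rel (HRel.d_x_ne i j hij)

theorem d_mul_x (i : Fin m) : (d i * x i : HWeyl m) = x i * d i + h ^ 2 := by
  simpa [x, d, h] using mk_rel (HRel.d_x_eq i)

theorem d_mul_x_pow (i : Fin m) (n : ℕ) :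
    (d i * x i ^ n : HWeyl m) = x i ^ n * d i + (n : ℂ) • (h ^ 2 * x i ^ (n - 1)) := by
  induction n with
  | zero => simp
  | succ n ih =>
    have hc : x i ^ n * h ^ 2 = (h ^ 2 * x i ^ n : HWeyl m) :=
      (((h_commute (x i)).pow_left 2).pow_right n).eq.symm
    have h1 : (n : ℂ) • (h ^ 2 * x i ^ (n - 1)) * x i = (n : ℂ) • (h ^ 2 * x i ^ n : HWeyl m) := by
      rcases n with _ | n
      · simp
      · simp [mul_assoc, pow_succ]
    rw [pow_succ, ← mul_assoc, ih, add_mul, mul_assoc, d_mul_x, mul_add, ← mul_assoc, h1, hc,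
      Nat.add_sub_cancel, Nat.cast_succ, add_smul, one_smul]
    abel

/-! ### Normal forms -/

section Lists

variable {R : Type*} [Ring R] (y : Fin m → R)

theorem list_prod_pow_congr (l : List (Fin m)) {α β : Fin m → ℕ} (hαβ : ∀ j ∈ l, α j = β j) :
    (l.map fun j => y j ^ α j).prod = (l.map fun j => y j ^ β j).prod := by
  congr 1
  exact List.map_congr_left fun j hj => by rw [hαβ j hj]

theorem commute_list_prod_pow {f : R} (l : List (Fin m)) (α : Fin m → ℕ)
    (hf : ∀ j ∈ l, Commute f (y j)) : Commute f (l.map fun j => y j ^ α j).prod := by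
  refine Commute.list_prod_right _ _ fun z hz => ?_
  obtain ⟨j, hj, rfl⟩ := List.mem_map.1 hz
  exact (hf j hj).pow_right _

theorem mul_list_prod_pow (hy : ∀ i j, Commute (y i) (y j)) (i : Fin m) {α β : Fin m → ℕ}
    (hi : β i = α i + 1) (hne : ∀ j, j ≠ i → β j = α j) :
    ∀ l : List (Fin m), l.Nodup → i ∈ l →
      y i * (l.map fun j => y j ^ α j).prod = (l.map fun j => y j ^ β j).prod
  | [], _, hl => by simp at hl
  | j :: l, hn, hl => by
    rw [List.nodup_cons] at hn
    simp only [List.map_cons, List.prod_cons]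
    by_cases hji : j = i
    · subst hji
      rw [hi, ← mul_assoc, pow_succ']
      congr 1
      exact list_prod_pow_congr y l fun k hk => (hne k fun hkj => hn.1 (hkj ▸ hk)).symm
    · have hl' : i ∈ l := by
        rcases List.mem_cons.1 hl with h | h
        · exact absurd h.symm hji
        · exact h
      rw [← mul_assoc, ((hy i j).pow_right _).eq, mul_assoc,
        mul_list_prod_pow hy i hi hne l hn.2 hl', hne j hji]

end Lists

theorem d_mul_list_prod_x (i : Fin m) {α β : Fin m → ℕ}
    (hi : β i = α i - 1) (hne : ∀ j, j ≠ i → β j = α j) :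
    ∀ l : List (Fin m), l.Nodup → i ∈ l →
      d i * (l.map fun j => x j ^ α j).prod = (l.map fun j => x j ^ α j).prod * d i
        + (α i : ℂ) • (h ^ 2 * (l.map fun j => x j ^ β j).prod : HWeyl m)
  | [], _, hl => by simp at hl
  | j :: l, hn, hl => by
    rw [List.nodup_cons] at hn
    simp only [List.map_cons, List.prod_cons]
    by_cases hji : j = i
    · subst hji
      have hc : Commute (d j : HWeyl m) (l.map fun j => x j ^ α j).prod :=
        commute_list_prod_pow _ l α fun k hk => d_commute_x fun hkj => hn.1 (hkj ▸ hk)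
      have hβ : (l.map fun j => (x j : HWeyl m) ^ β j).prod = (l.map fun j => x j ^ α j).prod :=
        list_prod_pow_congr _ l fun k hk => hne k fun hkj => hn.1 (hkj ▸ hk)
      rw [hi, hβ, ← mul_assoc, d_mul_x_pow, add_mul, mul_assoc, hc.eq]
      simp only [smul_mul_assoc, mul_assoc]
    · have hl' : i ∈ l := by
        rcases List.mem_cons.1 hl with h | h
        · exact absurd h.symm hji
        · exact h
      have hc : (x j ^ α j * h ^ 2 : HWeyl m) = h ^ 2 * x j ^ α j :=
        (((h_commute (x j)).pow_left 2).pow_right _).eq.symm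
      rw [← mul_assoc, ((d_commute_x (Ne.symm hji)).pow_right _).eq, mul_assoc,
        d_mul_list_prod_x i hi hne l hn.2 hl', hne j hji, mul_add, mul_smul_comm, mul_assoc,
        ← mul_assoc _ (h ^ 2), hc, mul_assoc]

theorem h_mul_mono (e : HGen m →₀ ℕ) : h * mono e = mono (Finsupp.single .h 1 + e) := by
  simp [mono, add_comm 1, pow_succ', mul_assoc]

theorem x_mul_mono (i : Fin m) (e : HGen m →₀ ℕ) :
    x i * mono e = mono (Finsupp.single (.x i) 1 + e) := by
  simp only [mono]
  rw [← mul_assoc, ← mul_assoc, ← ((h_commute (x i)).pow_left _).eq, mul_assoc (h ^ _),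
    mul_list_prod_pow x x_commute i (α := fun j => e (.x j))
      (β := fun j => (Finsupp.single (HGen.x i) 1 + e : HGen m →₀ ℕ) (.x j))
      (by simp [add_comm]) (fun j hj => by simp [Ne.symm hj]) _ (List.nodup_finRange m)
      (List.mem_finRange i)]
  simp

/-- The truncated subtraction is harmless: when the exponent of $x_i$ is 0, so is the coefficient of
that term. -/
theorem d_mul_mono (i : Fin m) (e : HGen m →₀ ℕ) :
    d i * mono e = mono (Finsupp.single (.d i) 1 + e)
      + (e (.x i) : ℂ) • mono (Finsupp.single .h 2 + (e - Finsupp.single (.x i) 1)) := by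
  simp only [mono]
  rw [← mul_assoc, ← mul_assoc, ← ((h_commute (d i)).pow_left _).eq, mul_assoc (h ^ _),
    d_mul_list_prod_x i (α := fun j => e (.x j))
      (β := fun j =>
        (Finsupp.single HGen.h 2 + (e - Finsupp.single (HGen.x i) 1) : HGen m →₀ ℕ) (.x j))
      (by simp) (fun j hj => by simp [Ne.symm hj]) _ (List.nodup_finRange m)
      (List.mem_finRange i), mul_add, add_mul, ← mul_assoc (h ^ _), mul_assoc _ (d i),
    mul_list_prod_pow d d_commute i (α := fun j => e (.d j))
      (β := fun j => (Finsupp.single (HGen.d i) 1 + e : HGen m →₀ ℕ) (.d j))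
      (by simp [add_comm]) (fun j hj => by simp [Ne.symm hj]) _ (List.nodup_finRange m)
      (List.mem_finRange i)]
  have hp : (h ^ e .h * h ^ 2 : HWeyl m) = h ^ (2 + e .h) := by rw [← pow_add, add_comm]
  simp [← mul_assoc, hp]

/-- The operator with a given total symbol. -/
noncomputable def ofSymbol (m : ℕ) : MvPolynomial (HGen m) ℂ →ₗ[ℂ] HWeyl m :=
  (MvPolynomial.basisMonomials (HGen m) ℂ).constr ℂ mono

theorem ofSymbol_monomial (e : HGen m →₀ ℕ) (r : ℂ) :
    ofSymbol m (MvPolynomial.monomial e r) = r • mono e := by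
  have := (MvPolynomial.basisMonomials (HGen m) ℂ).constr_basis ℂ (mono (m := m)) e
  rw [MvPolynomial.coe_basisMonomials] at this
  rw [← mul_one r, ← smul_eq_mul, ← MvPolynomial.smul_monomial, map_smul, smul_eq_mul, mul_one]
  exact congrArg (r • ·) this

theorem symbolAct_h : symbolAct m h = symbolGen .h := lift_mk_ι _ _ _

theorem symbolAct_x (i : Fin m) : symbolAct m (x i) = symbolGen (.x i) := lift_mk_ι _ _ _

theorem symbolAct_d (i : Fin m) : symbolAct m (d i) = symbolGen (.d i) := lift_mk_ι _ _ _

theorem symbolGen_h_monomial (e : HGen m →₀ ℕ) (r : ℂ) :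
    symbolGen .h (MvPolynomial.monomial e r)
      = MvPolynomial.monomial (Finsupp.single .h 1 + e) r := by
  simp [symbolGen, MvPolynomial.X, MvPolynomial.monomial_mul]

theorem symbolGen_x_monomial (i : Fin m) (e : HGen m →₀ ℕ) (r : ℂ) :
    symbolGen (.x i) (MvPolynomial.monomial e r)
      = MvPolynomial.monomial (Finsupp.single (.x i) 1 + e) r := by
  simp [symbolGen, MvPolynomial.X, MvPolynomial.monomial_mul]

theorem symbolGen_d_monomial (i : Fin m) (e : HGen m →₀ ℕ) (r : ℂ) :
    symbolGen (.d i) (MvPolynomial.monomial e r)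
      = MvPolynomial.monomial (Finsupp.single (.d i) 1 + e) r
        + MvPolynomial.monomial (Finsupp.single .h 2 + (e - Finsupp.single (.x i) 1))
          (r * e (.x i)) := by
  simp [symbolGen, MvPolynomial.pderiv_monomial, MvPolynomial.X,
    MvPolynomial.monomial_pow, MvPolynomial.monomial_mul]

/-- The action on symbols was modelled on left multiplication of normally ordered expressions, so it
suffices to compare the two on generators and monomials. Applied to the symbol 1, this shows that
every element is recovered from its symbol. -/
theorem ofSymbol_symbolAct (f : HWeyl m) (p : MvPolynomial (HGen m) ℂ) :
    ofSymbol m (symbolAct m f p) = f * ofSymbol m p := by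
  induction f using HWeyl.induction generalizing p with
  | algebraMap r => simp [Algebra.algebraMap_eq_smul_one]
  | h =>
    induction p using MvPolynomial.induction_on' with
    | monomial e r => simp [symbolAct_h, symbolGen_h_monomial, ofSymbol_monomial, h_mul_mono]
    | add p q hp hq => simp only [map_add, hp, hq, mul_add]
  | x i =>
    induction p using MvPolynomial.induction_on' with
    | monomial e r => simp [symbolAct_x, symbolGen_x_monomial, ofSymbol_monomial, x_mul_mono]
    | add p q hp hq => simp only [map_add, hp, hq, mul_add]
  | d i =>
    induction p using MvPolynomial.induction_on' with
    | monomial e r =>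
      simp [symbolAct_d, symbolGen_d_monomial, ofSymbol_monomial, d_mul_mono, mul_smul]
    | add p q hp hq => simp only [map_add, hp, hq, mul_add]
  | mul f g hf hg => rw [map_mul, Module.End.mul_apply, hf, hg, mul_assoc]
  | add f g hf hg => rw [map_add, LinearMap.add_apply, map_add, hf, hg, add_mul]

theorem mono_zero : mono (0 : HGen m →₀ ℕ) = 1 := by simp [mono]

theorem ofSymbol_symbol (f : HWeyl m) : ofSymbol m (symbol m f) = f := by
  have := ofSymbol_symbolAct f 1
  rwa [← MvPolynomial.C_1, MvPolynomial.C_apply, ofSymbol_monomial, mono_zero, one_smul,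
    mul_one] at this

theorem symbol_injective : Function.Injective (symbol m) :=
  Function.LeftInverse.injective ofSymbol_symbol

theorem symbol_mul (f g : HWeyl m) : symbol m (f * g) = symbolAct m f (symbol m g) := by
  simp [symbol]

/-! ### The monomial order -/

theorem key_add (e e' : HGen m →₀ ℕ) : key (e + e') = key e + key e' := by
  simp only [key, Finsupp.add_apply, Finset.sum_add_distrib, Nat.cast_add]
  refine congrArg toLex (Prod.ext ?_ (congrArg toLex (Prod.ext ?_ rfl)))
  · change _ = (_ + _ + _ : ℕ) + (_ + _ + _ : ℕ)
    ring
  · change _ = (_ - _ : ℤ) + (_ - _ : ℤ)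
    ring

/-- The key does not record the exponent of $h$, but the total degree determines it from the others.
-/
theorem key_injective : Function.Injective (key (m := m)) := by
  intro e e' hee
  simp only [key, EmbeddingLike.apply_eq_iff_eq, Prod.mk.injEq] at hee
  obtain ⟨hdeg, -, hd, hx⟩ := hee
  have hd' : ∀ i, e (.d i) = e' (.d i) := fun i => congrFun hd i
  have hx' : ∀ i, e (.x i) = e' (.x i) := fun i => congrFun hx i
  simp only [hd', hx'] at hdeg
  ext g
  cases g with
  | h => omega
  | x i => exact hx' i
  | d i => exact hd' i

theorem key_lt_key_iff (e e' : HGen m →₀ ℕ) : key e < key e' ↔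
    (e .h + ∑ i : Fin m, e (.x i) + ∑ i : Fin m, e (.d i)
        < e' .h + ∑ i : Fin m, e' (.x i) + ∑ i : Fin m, e' (.d i)) ∨
    (e .h + ∑ i : Fin m, e (.x i) + ∑ i : Fin m, e (.d i)
        = e' .h + ∑ i : Fin m, e' (.x i) + ∑ i : Fin m, e' (.d i)) ∧
      ((∑ i : Fin m, (e (.d i) : ℤ)) - ∑ i : Fin m, (e (.x i) : ℤ)
        < (∑ i : Fin m, (e' (.d i) : ℤ)) - ∑ i : Fin m, (e' (.x i) : ℤ) ∨
      (∑ i : Fin m, (e (.d i) : ℤ)) - ∑ i : Fin m, (e (.x i) : ℤ)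
        = (∑ i : Fin m, (e' (.d i) : ℤ)) - ∑ i : Fin m, (e' (.x i) : ℤ) ∧
      toLex (toLex fun i => e (.d i), toLex fun i => e (.x i))
        < toLex (toLex fun i => e' (.d i), toLex fun i => e' (.x i))) := by
  simp [key, Prod.Lex.lt_iff]

/-- The weight can be negative, but within a fixed total degree it may be replaced by degree plus
weight, $k+2|\beta|$, which is a natural number. -/
theorem wellFounded_key : WellFounded fun e e' : HGen m →₀ ℕ => key e < key e' := by
  let κ : (HGen m →₀ ℕ) → ℕ ×ₗ (ℕ ×ₗ (Lex (Fin m → ℕ) ×ₗ Lex (Fin m → ℕ))) := fun e =>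
    toLex (e .h + ∑ i : Fin m, e (.x i) + ∑ i : Fin m, e (.d i),
      toLex (e .h + 2 * ∑ i : Fin m, e (.d i),
        toLex (toLex fun i => e (.d i), toLex fun i => e (.x i))))
  refine Subrelation.wf (r := InvImage (· < ·) κ) (fun {e e'} hlt => ?_) (InvImage.wf κ wellFounded_lt)
  rw [key_lt_key_iff] at hlt
  simp only [InvImage, κ, Prod.Lex.lt_iff, ofLex_toLex]
  simp only [← Nat.cast_sum] at hlt
  rcases hlt with h1 | ⟨h1, h2 | ⟨h2, h3⟩⟩
  · exact Or.inl h1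
  · exact Or.inr ⟨h1, Or.inl (by omega)⟩
  · exact Or.inr ⟨h1, Or.inr ⟨by omega, by rwa [Prod.Lex.lt_iff] at h3⟩⟩

theorem key_add_lt_add_left {e e' : HGen m →₀ ℕ} (hee : key e < key e') (u : HGen m →₀ ℕ) :
    key (u + e) < key (u + e') := by
  rw [key_add, key_add]
  exact add_lt_add_right hee _

theorem key_add_lt_add_right {e e' : HGen m →₀ ℕ} (hee : key e < key e') (u : HGen m →₀ ℕ) :
    key (e + u) < key (e' + u) := by
  rw [add_comm e, add_comm e']
  exact key_add_lt_add_left hee u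

/-! ### Symbols below a given key -/

/-- The polynomials all of whose monomials have a key below `δ`. -/
noncomputable def lowSymbols (δ : Key m) : Submodule ℂ (MvPolynomial (HGen m) ℂ) :=
  MvPolynomial.restrictSupport ℂ {e | key e < δ}

theorem mem_lowSymbols {δ : Key m} {p : MvPolynomial (HGen m) ℂ} :
    p ∈ lowSymbols δ ↔ ∀ e ∈ p.support, key e < δ := by
  rw [lowSymbols, MvPolynomial.mem_restrictSupport_iff]
  rfl

theorem monomial_mem_lowSymbols {δ : Key m} {e : HGen m →₀ ℕ} (he : key e < δ) (r : ℂ) :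
    MvPolynomial.monomial e r ∈ lowSymbols δ := by
  rw [mem_lowSymbols]
  intro e' he'
  rwa [Finset.mem_singleton.1 (MvPolynomial.support_monomial_subset he')]

theorem lowSymbols_mono {δ δ' : Key m} (hδ : δ ≤ δ') : lowSymbols δ ≤ lowSymbols δ' :=
  fun _ hp => mem_lowSymbols.2 fun e he => (mem_lowSymbols.1 hp e he).trans_le hδ

theorem lowSymbols_le_iff {δ : Key m} {N : Submodule ℂ (MvPolynomial (HGen m) ℂ)} :
    lowSymbols δ ≤ N ↔ ∀ e, key e < δ → MvPolynomial.monomial e 1 ∈ N := by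
  rw [lowSymbols, MvPolynomial.restrictSupport_eq_span, Submodule.span_le]
  simp [Set.subset_def]

/-- The operator `A` on polynomials multiplies monomials by `c` times the monomial with exponent
`e`, up to terms with smaller keys. -/
def ShiftsBy (A : Module.End ℂ (MvPolynomial (HGen m) ℂ)) (e : HGen m →₀ ℕ) (c : ℂ) : Prop :=
  ∀ e', A (MvPolynomial.monomial e' 1) - MvPolynomial.monomial (e + e') c
    ∈ lowSymbols (key (e + e'))

namespace ShiftsBy

variable {A B : Module.End ℂ (MvPolynomial (HGen m) ℂ)} {e u : HGen m →₀ ℕ} {c r : ℂ}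

theorem apply_mem_of_lt (hA : ShiftsBy A e c) {e' : HGen m →₀ ℕ} {δ : Key m}
    (hδ : key (e + e') < δ) : A (MvPolynomial.monomial e' 1) ∈ lowSymbols δ := by
  have := add_mem (lowSymbols_mono hδ.le (hA e')) (monomial_mem_lowSymbols hδ c)
  simpa using this

theorem apply_mem (hA : ShiftsBy A e c) {e' : HGen m →₀ ℕ} {p : MvPolynomial (HGen m) ℂ}
    (hp : p ∈ lowSymbols (key e')) : A p ∈ lowSymbols (key (e + e')) := by
  have : lowSymbols (key e') ≤ (lowSymbols (key (e + e'))).comap A :=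
    lowSymbols_le_iff.2 fun e'' he'' => hA.apply_mem_of_lt (key_add_lt_add_left he'' e)
  exact this hp

theorem apply_sub_mem (hA : ShiftsBy A e c) {e' : HGen m →₀ ℕ} {p : MvPolynomial (HGen m) ℂ}
    (hp : p - MvPolynomial.monomial e' r ∈ lowSymbols (key e')) :
    A p - MvPolynomial.monomial (e + e') (c * r) ∈ lowSymbols (key (e + e')) := by
  have h1 := hA.apply_mem hp
  have h2 := (lowSymbols (key (e + e'))).smul_mem r (hA e')
  rw [map_sub] at h1
  rw [smul_sub, ← map_smul, MvPolynomial.smul_monomial, MvPolynomial.smul_monomial] at h2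
  convert add_mem h1 h2 using 1
  simp [mul_comm]

theorem mul (hA : ShiftsBy A e c) (hB : ShiftsBy B u r) : ShiftsBy (A * B) (e + u) (c * r) := by
  intro e'
  rw [add_assoc]
  exact hA.apply_sub_mem (hB e')

theorem one : ShiftsBy (1 : Module.End ℂ (MvPolynomial (HGen m) ℂ)) 0 1 := by
  intro e'
  simp

theorem pow (hA : ShiftsBy A e 1) (n : ℕ) : ShiftsBy (A ^ n) (n • e) 1 := by
  induction n with
  | zero => simpa using one
  | succ n ih => simpa [pow_succ, add_smul] using ih.mul hA

theorem list_prod {ι : Type*} {A : ι → Module.End ℂ (MvPolynomial (HGen m) ℂ)}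
    {e : ι → HGen m →₀ ℕ} (hA : ∀ i, ShiftsBy (A i) (e i) 1) :
    ∀ l : List ι, ShiftsBy (l.map A).prod (l.map e).sum 1
  | [] => by simpa using one
  | i :: l => by simpa using (hA i).mul (list_prod hA l)

end ShiftsBy

/-- Only $\partial_i$ produces a correction term. It has $h^2$ in place of $x_i\partial_i$: equal
degree, equal weight, smaller exponent of $\partial_i$. -/
theorem shiftsBy_symbolGen (g : HGen m) : ShiftsBy (symbolGen g) (Finsupp.single g 1) 1 := by
  classical
  intro e'
  cases g with
  | h => simp [symbolGen_h_monomial]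
  | x i => simp [symbolGen_x_monomial]
  | d i =>
    rw [symbolGen_d_monomial, add_sub_cancel_left]
    by_cases hi : e' (.x i) = 0
    · simp [hi]
    refine monomial_mem_lowSymbols ?_ _
    obtain ⟨u, rfl⟩ : ∃ u, e' = Finsupp.single (.x i) 1 + u :=
      ⟨e' - Finsupp.single (.x i) 1,
        (add_tsub_cancel_of_le (Finsupp.single_le_iff.2 (Nat.one_le_iff_ne_zero.2 hi))).symm⟩
    rw [add_tsub_cancel_left, ← add_assoc]
    refine key_add_lt_add_right ?_ u
    rw [key_lt_key_iff]
    refine Or.inr ⟨by simp [Finsupp.single_apply], Or.inr ⟨by simp [Finsupp.single_apply], ?_⟩⟩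
    rw [Prod.Lex.lt_iff]
    left
    refine ⟨i, fun j hj => ?_, ?_⟩
    · simp [Finsupp.single_apply, hj.ne']
    · simp

theorem exponent_eq_sum (e : HGen m →₀ ℕ) :
    e = Finsupp.single .h (e .h) + (∑ i : Fin m, Finsupp.single (.x i) (e (.x i)))
        + ∑ i : Fin m, Finsupp.single (.d i) (e (.d i)) := by
  classical
  ext g
  cases g <;> simp [Finsupp.single_apply]

theorem shiftsBy_mono (e : HGen m →₀ ℕ) : ShiftsBy (symbolAct m (mono e)) e 1 := by
  have hh : ShiftsBy (symbolAct m (h ^ e .h)) (Finsupp.single .h (e .h)) 1 := by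
    simpa [symbolAct_h] using (shiftsBy_symbolGen (m := m) .h).pow (e .h)
  have hx : ShiftsBy (symbolAct m ((List.finRange m).map fun i => x i ^ e (.x i)).prod)
      (∑ i : Fin m, Finsupp.single (.x i) (e (.x i))) 1 := by
    rw [map_list_prod, List.map_map, ← List.sum_ofFn, List.ofFn_eq_map]
    refine ShiftsBy.list_prod (fun i => ?_) _
    simpa [symbolAct_x] using (shiftsBy_symbolGen (m := m) (.x i)).pow (e (.x i))
  have hd : ShiftsBy (symbolAct m ((List.finRange m).map fun i => d i ^ e (.d i)).prod)
      (∑ i : Fin m, Finsupp.single (.d i) (e (.d i))) 1 := by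
    rw [map_list_prod, List.map_map, ← List.sum_ofFn, List.ofFn_eq_map]
    refine ShiftsBy.list_prod (fun i => ?_) _
    simpa [symbolAct_d] using (shiftsBy_symbolGen (m := m) (.d i)).pow (e (.d i))
  have := (hh.mul hx).mul hd
  rw [← exponent_eq_sum, ← map_mul, ← map_mul, mul_one, mul_one] at this
  exact this

/-- The counterpart of `ShiftsBy.apply_mem` for lower terms in the operator instead of its argument;
by linearity only monomial operators need checking. -/
theorem symbolAct_ofSymbol_mem {p : MvPolynomial (HGen m) ℂ} {e : HGen m →₀ ℕ}
    (hp : p ∈ lowSymbols (key e)) (e' : HGen m →₀ ℕ) :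
    symbolAct m (ofSymbol m p) (MvPolynomial.monomial e' 1) ∈ lowSymbols (key (e + e')) := by
  have : lowSymbols (key e) ≤ (lowSymbols (key (e + e'))).comap
      (LinearMap.applyₗ (MvPolynomial.monomial e' (1 : ℂ)) ∘ₗ (symbolAct m).toLinearMap
        ∘ₗ ofSymbol m) := by
    refine lowSymbols_le_iff.2 fun u hu => ?_
    simp only [Submodule.mem_comap, LinearMap.comp_apply, LinearMap.applyₗ_apply_apply,
      ofSymbol_monomial, one_smul, AlgHom.toLinearMap_apply]
    exact (shiftsBy_mono u).apply_mem_of_lt (key_add_lt_add_right hu e')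
  exact this hp

/-! ### Top coefficients -/

/-- No monomial of `f` has a key above that of `e`, and the coefficient of the monomial with
exponent `e` is `c`. -/
def IsTop (f : HWeyl m) (e : HGen m →₀ ℕ) (c : ℂ) : Prop :=
  symbol m f - MvPolynomial.monomial e c ∈ lowSymbols (key e)

theorem IsTop.shiftsBy {f : HWeyl m} {e : HGen m →₀ ℕ} {c : ℂ} (hf : IsTop f e c) :
    ShiftsBy (symbolAct m f) e c := by
  intro e'
  have h1 := symbolAct_ofSymbol_mem hf e'
  rw [map_sub, ofSymbol_symbol, ofSymbol_monomial, map_sub, LinearMap.sub_apply, map_smul,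
    LinearMap.smul_apply] at h1
  have h2 := Submodule.smul_mem _ c (shiftsBy_mono e e')
  rw [smul_sub, MvPolynomial.smul_monomial, smul_eq_mul, mul_one] at h2
  convert add_mem h1 h2 using 1
  abel

namespace IsTop

variable {f g : HWeyl m} {e e' : HGen m →₀ ℕ} {c c' : ℂ}

/-- Leading terms multiply as in a commutative polynomial ring. The coefficients may vanish, so the
rule also covers factors lying strictly below the stated exponents. -/
theorem mul (hf : IsTop f e c) (hg : IsTop g e' c') : IsTop (f * g) (e + e') (c * c') := by
  rw [IsTop, symbol_mul]
  exact hf.shiftsBy.apply_sub_mem hg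

theorem add (hf : IsTop f e c) (hg : IsTop g e c') : IsTop (f + g) e (c + c') := by
  rw [IsTop, map_add, map_add, add_sub_add_comm]
  exact add_mem hf hg

theorem smul (r : ℂ) (hf : IsTop f e c) : IsTop (r • f) e (r * c) := by
  rw [IsTop, map_smul, ← smul_eq_mul, ← MvPolynomial.smul_monomial, ← smul_sub]
  exact Submodule.smul_mem _ r hf

theorem neg (hf : IsTop f e c) : IsTop (-f) e (-c) := by
  simpa using hf.smul (-1)

theorem sub (hf : IsTop f e c) (hg : IsTop g e c') : IsTop (f - g) e (c - c') := by
  simpa [sub_eq_add_neg] using hf.add hg.neg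

theorem zero : IsTop (0 : HWeyl m) e 0 := by simp [IsTop]

theorem sum {ι : Type*} {s : Finset ι} {f : ι → HWeyl m} {c : ι → ℂ}
    (hf : ∀ i ∈ s, IsTop (f i) e (c i)) : IsTop (∑ i ∈ s, f i) e (∑ i ∈ s, c i) := by
  classical
  induction s using Finset.induction_on with
  | empty => simpa using zero
  | insert i s hi ih =>
    rw [Finset.sum_insert hi, Finset.sum_insert hi]
    exact (hf i (Finset.mem_insert_self i s)).add
      (ih fun j hj => hf j (Finset.mem_insert_of_mem hj))

theorem coeff_eq (hf : IsTop f e c) : (symbol m f).coeff e = c := by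
  classical
  have : e ∉ (symbol m f - MvPolynomial.monomial e c).support := fun he =>
    lt_irrefl _ (mem_lowSymbols.1 hf e he)
  rw [MvPolynomial.notMem_support_iff] at this
  simpa [sub_eq_zero, MvPolynomial.coeff_monomial] using this

theorem unique (hf : IsTop f e c) (hf' : IsTop f e c') : c = c' := by
  rw [← hf.coeff_eq, hf'.coeff_eq]

theorem ne_zero (hf : IsTop f e c) (hc : c ≠ 0) : f ≠ 0 := by
  rintro rfl
  exact hc (hf.unique zero)

end IsTop

/-- Top coefficient 0 encodes "strictly below", so strict bounds and leading terms obey the same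
additive and multiplicative rules. -/
theorem leadKey_lt_iff {f : HWeyl m} {e : HGen m →₀ ℕ} : leadKey f < key e ↔ IsTop f e 0 := by
  rw [leadKey, Finset.sup_lt_iff (WithBot.bot_lt_coe _), IsTop, mem_lowSymbols]
  simp

theorem leadKey_le_iff {f : HWeyl m} {e : HGen m →₀ ℕ} :
    leadKey f ≤ key e ↔ ∃ c, IsTop f e c := by
  classical
  simp only [leadKey, Finset.sup_le_iff, WithBot.coe_le_coe]
  constructor
  · intro hf
    refine ⟨(symbol m f).coeff e, ?_⟩
    rw [IsTop, mem_lowSymbols]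
    intro e' he'
    rw [MvPolynomial.mem_support_iff, MvPolynomial.coeff_sub, MvPolynomial.coeff_monomial] at he'
    have hne : e ≠ e' := by
      rintro rfl
      simp at he'
    rw [if_neg hne, sub_zero] at he'
    exact lt_of_le_of_ne (hf e' (MvPolynomial.mem_support_iff.2 he'))
      fun hk => hne (key_injective hk).symm
  · rintro ⟨c, hf⟩ e' he'
    by_cases hne : e = e'
    · rw [hne]
    · refine (mem_lowSymbols.1 hf e' ?_).le
      rw [MvPolynomial.mem_support_iff, MvPolynomial.coeff_sub, MvPolynomial.coeff_monomial,
        if_neg hne, sub_zero]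
      exact MvPolynomial.mem_support_iff.1 he'

theorem IsTop.leadKey_eq {f : HWeyl m} {e : HGen m →₀ ℕ} {c : ℂ} (hf : IsTop f e c)
    (hc : c ≠ 0) : leadKey f = key e :=
  le_antisymm (leadKey_le_iff.2 ⟨c, hf⟩)
    (not_lt.1 fun hlt => hc (hf.unique (leadKey_lt_iff.1 hlt)))

theorem IsTop.of_lt {f : HWeyl m} {e e' : HGen m →₀ ℕ} {c : ℂ} (hf : IsTop f e c)
    (hlt : key e < key e') : IsTop f e' 0 :=
  leadKey_lt_iff.1 ((leadKey_le_iff.2 ⟨c, hf⟩).trans_lt (WithBot.coe_lt_coe.2 hlt))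

theorem leadKey_zero : leadKey (0 : HWeyl m) = ⊥ := by simp [leadKey]

theorem exists_isTop {f : HWeyl m} (hf : f ≠ 0) : ∃ e c, c ≠ 0 ∧ IsTop f e c := by
  have hs : (symbol m f).support.Nonempty := by
    rw [Finset.nonempty_iff_ne_empty, Ne, MvPolynomial.support_eq_empty]
    exact fun h0 => hf (symbol_injective (by rw [h0, map_zero]))
  obtain ⟨e, he, hmax⟩ := Finset.exists_max_image _ key hs
  obtain ⟨c, hc⟩ := leadKey_le_iff.1 (Finset.sup_le fun e' he' =>
    WithBot.coe_le_coe.2 (hmax e' he') : leadKey f ≤ key e)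
  exact ⟨e, c, hc.coeff_eq ▸ MvPolynomial.mem_support_iff.1 he, hc⟩

theorem leadKey_eq_bot_iff {f : HWeyl m} : leadKey f = ⊥ ↔ f = 0 := by
  refine ⟨fun hf => ?_, fun hf => hf ▸ leadKey_zero⟩
  by_contra hne
  obtain ⟨e, c, hc, he⟩ := exists_isTop hne
  rw [he.leadKey_eq hc] at hf
  exact WithBot.coe_ne_bot hf

theorem IsTop.leadExp_eq {f : HWeyl m} {e : HGen m →₀ ℕ} {c : ℂ} (hf : IsTop f e c)
    (hc : c ≠ 0) : leadExp f = e := by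
  have hex : ∃ e ∈ (symbol m f).support, (key e : WithBot (Key m)) = leadKey f :=
    ⟨e, MvPolynomial.mem_support_iff.2 (hf.coeff_eq ▸ hc), (hf.leadKey_eq hc).symm⟩
  rw [leadExp, dif_pos hex]
  have := hex.choose_spec.2
  exact key_injective (WithBot.coe_inj.1 (this.trans (hf.leadKey_eq hc)))

theorem IsTop.leadCoeff_eq {f : HWeyl m} {e : HGen m →₀ ℕ} {c : ℂ} (hf : IsTop f e c)
    (hc : c ≠ 0) : leadCoeff f = c := by
  rw [leadCoeff, hf.leadExp_eq hc, hf.coeff_eq]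

theorem isTop_lead {f : HWeyl m} (hf : f ≠ 0) :
    leadCoeff f ≠ 0 ∧ IsTop f (leadExp f) (leadCoeff f) := by
  obtain ⟨e, c, hc, he⟩ := exists_isTop hf
  rw [he.leadExp_eq hc, he.leadCoeff_eq hc]
  exact ⟨hc, he⟩

theorem isTop_mono (e : HGen m →₀ ℕ) : IsTop (mono e) e 1 := by
  simp [IsTop, symbol_mono]

instance : NoZeroDivisors (HWeyl m) where
  eq_zero_or_eq_zero_of_mul_eq_zero {f g} hfg := by
    by_contra! hne
    obtain ⟨hf, hf'⟩ := isTop_lead hne.1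
    obtain ⟨hg, hg'⟩ := isTop_lead hne.2
    exact (hf'.mul hg').ne_zero (mul_ne_zero hf hg) hfg

/-! ### Critical relations and reduction -/

section Reduction

variable {ι : Type*} [Fintype ι]

/-- A relation `∑ w_k g_k = 0` in which the summands of `p` and `q` have the least common multiple
of the leading monomials of `g_p` and `g_q` as leading monomial, and all others lie below it. -/
structure IsCritical (g : ι → HWeyl m) (p q : ι) (w : ι → HWeyl m) : Prop where
  sum_eq_zero : ∑ k, w k * g k = 0
  top_left : ∃ c, c ≠ 0 ∧ IsTop (w p * g p) (leadExp (g p) ⊔ leadExp (g q)) c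
  top_right : ∃ c, c ≠ 0 ∧ IsTop (w q * g q) (leadExp (g p) ⊔ leadExp (g q)) c
  low : ∀ k, k ≠ p → k ≠ q → IsTop (w k * g k) (leadExp (g p) ⊔ leadExp (g q)) 0

variable {g : ι → HWeyl m} {p q s : ι} {w w' : ι → HWeyl m}

theorem IsCritical.symm (hw : IsCritical g p q w) : IsCritical g q p w where
  sum_eq_zero := hw.sum_eq_zero
  top_left := by rw [sup_comm]; exact hw.top_right
  top_right := by rw [sup_comm]; exact hw.top_left
  low k hq hp := by rw [sup_comm]; exact hw.low k hp hq

theorem sum_smul_mul (f : HWeyl m) (w g : ι → HWeyl m) :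
    ∑ k, (f • w) k * g k = f * ∑ k, w k * g k := by
  simp [mul_assoc, Finset.mul_sum]

theorem sum_sub_mul (v w g : ι → HWeyl m) :
    ∑ k, (v - w) k * g k = ∑ k, v k * g k - ∑ k, w k * g k := by
  simp [sub_mul, Finset.sum_sub_distrib]

theorem IsTop.mono_mul {f : HWeyl m} {e e' : HGen m →₀ ℕ} {c : ℂ} (hf : IsTop f e c)
    (hle : e ≤ e') : IsTop (mono (e' - e) * f) e' c := by
  simpa [tsub_add_cancel_of_le hle] using (isTop_mono (e' - e)).mul hf

/-- The chain criterion. -/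
theorem IsCritical.chain (hw : IsCritical g p s w) (hw' : IsCritical g s q w') (hpq : p ≠ q)
    (hps : p ≠ s) (hsq : s ≠ q) (hs : leadExp (g s) ≤ leadExp (g p) ⊔ leadExp (g q)) :
    ∃ f f' : HWeyl m, IsCritical g p q (f • w - f' • w') := by
  obtain ⟨c, hc, hcw⟩ := hw.top_right
  obtain ⟨c', hc', hcw'⟩ := hw'.top_left
  obtain ⟨r, hr, hrw⟩ := hw.top_left
  obtain ⟨r', hr', hrw'⟩ := hw'.top_right
  have hle : leadExp (g p) ⊔ leadExp (g s) ≤ leadExp (g p) ⊔ leadExp (g q) :=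
    sup_le le_sup_left hs
  have hle' : leadExp (g s) ⊔ leadExp (g q) ≤ leadExp (g p) ⊔ leadExp (g q) :=
    sup_le hs le_sup_right
  -- Both relations are lifted to the least common multiple for $p$ and $q$. Scaling by the opposite
  -- coefficients makes the contributions of $s$ cancel: $c'c-cc'=0$.
  have key : ∀ {k : ι} {a b : ℂ}, IsTop (w k * g k) (leadExp (g p) ⊔ leadExp (g s)) a →
      IsTop (w' k * g k) (leadExp (g s) ⊔ leadExp (g q)) b →
      IsTop (((c' • mono (leadExp (g p) ⊔ leadExp (g q) - leadExp (g p) ⊔ leadExp (g s))) • w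
        - (c • mono (leadExp (g p) ⊔ leadExp (g q) - leadExp (g s) ⊔ leadExp (g q))) • w') k * g k)
        (leadExp (g p) ⊔ leadExp (g q)) (c' * a - c * b) := by
    intro k a b ha hb
    have := ((ha.mono_mul hle).smul c').sub ((hb.mono_mul hle').smul c)
    simpa [sub_mul, mul_assoc] using this
  refine ⟨c' • mono (leadExp (g p) ⊔ leadExp (g q) - leadExp (g p) ⊔ leadExp (g s)),
    c • mono (leadExp (g p) ⊔ leadExp (g q) - leadExp (g s) ⊔ leadExp (g q)), ?_, ?_, ?_, ?_⟩
  · rw [sum_sub_mul, sum_smul_mul, sum_smul_mul, hw.sum_eq_zero, hw'.sum_eq_zero]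
    simp
  · exact ⟨_, by simpa using ⟨hc', hr⟩, key hrw (hw'.low p hps hpq)⟩
  · exact ⟨_, by simpa using ⟨hc, hr'⟩, key (hw.low q hpq.symm hsq.symm) hrw'⟩
  · intro k hkp hkq
    by_cases hks : k = s
    · subst hks
      simpa [mul_comm] using key hcw hcw'
    · simpa using key (hw.low k hkp hks) (hw'.low k hks hkq)

theorem leadExp_le_of_isTop {f g : HWeyl m} {e : HGen m →₀ ℕ} {c : ℂ}
    (hc : c ≠ 0) (hfg : IsTop (f * g) e c) : leadExp g ≤ e := by
  have hne := hfg.ne_zero hc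
  obtain ⟨hf, hf'⟩ := isTop_lead (left_ne_zero_of_mul hne)
  obtain ⟨hg, hg'⟩ := isTop_lead (right_ne_zero_of_mul hne)
  rw [← hfg.leadExp_eq hc, (hf'.mul hg').leadExp_eq (mul_ne_zero hf hg)]
  exact le_add_self

/-- The outer induction is on a common upper bound $e$ for the leading monomials of the summands,
the inner one on the number of summands that attain it. Each inner step uses a critical relation to
remove one of them. -/
theorem exists_reduced_aux {N : Submodule (HWeyl m) (ι → HWeyl m)}
    (hN : ∀ p q, p ≠ q → ∃ w ∈ N, IsCritical g p q w) (e : HGen m →₀ ℕ) :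
    ∀ (n : ℕ) (V : ι → HWeyl m) (c : ι → ℂ), (∀ k, IsTop (V k * g k) e (c k)) →
      Set.ncard {k | c k ≠ 0} ≤ n →
      ∃ V' : ι → HWeyl m, V - V' ∈ N ∧
        ∀ k, leadKey (V' k * g k) ≤ leadKey (∑ k, V k * g k) := by
  classical
  induction e using wellFounded_key.induction with
  | _ e ihe =>
  intro n
  induction n with
  | zero =>
    intro V c hV hn
    have hc : ∀ k, c k = 0 := fun k => by
      have := (Set.ncard_eq_zero (Set.toFinite _)).1 (Nat.le_zero.1 hn)
      by_contra hk
      exact (Set.eq_empty_iff_forall_notMem.1 this) k hk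
    by_cases h0 : ∀ k, V k * g k = 0
    · exact ⟨V, by simp, fun k => by simp [h0, leadKey_zero]⟩
    push Not at h0
    obtain ⟨k₁, hk₁⟩ := h0
    -- No summand attains $e$, so the largest leading monomial among the summands is a strictly
    -- smaller bound.
    obtain ⟨k₀, -, hmax⟩ := Finset.exists_max_image Finset.univ (fun k => leadKey (V k * g k))
      ⟨k₁, Finset.mem_univ k₁⟩
    have hk₀ : V k₀ * g k₀ ≠ 0 := fun h0 => by
      have := hmax k₁ (Finset.mem_univ _)
      rw [h0, leadKey_zero, le_bot_iff, leadKey_eq_bot_iff] at this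
      exact hk₁ this
    obtain ⟨hcoeff, htop⟩ := isTop_lead hk₀
    have hlt : key (leadExp (V k₀ * g k₀)) < key e := by
      have := leadKey_lt_iff.2 (hc k₀ ▸ hV k₀)
      rwa [htop.leadKey_eq hcoeff, WithBot.coe_lt_coe] at this
    have hle : ∀ k, ∃ c, IsTop (V k * g k) (leadExp (V k₀ * g k₀)) c := fun k =>
      leadKey_le_iff.1 ((hmax k (Finset.mem_univ k)).trans (htop.leadKey_eq hcoeff).le)
    choose c' hc' using hle
    exact ihe _ hlt _ V c' hc' le_rfl
  | succ n ihn =>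
    intro V c hV hn
    have hsum := IsTop.sum fun k (_ : k ∈ Finset.univ) => hV k
    -- This sum is the coefficient of the total value at $e$. If it is nonzero, $e$ is the leading
    -- exponent of the value and nothing has to be changed. If it is zero, a nonzero coefficient has
    -- a nonzero partner.
    by_cases hz : ∑ k, c k = 0
    · by_cases hall : ∀ k, c k = 0
      · refine ihn V c hV ?_
        simp [hall]
      push Not at hall
      obtain ⟨p, hp⟩ := hall
      obtain ⟨q, hqp, hq⟩ : ∃ q, q ≠ p ∧ c q ≠ 0 := by
        by_contra! hno
        exact hp ((Finset.sum_eq_single p (fun k _ => hno k) (by simp)).symm.trans hz)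
      obtain ⟨w, hwN, hw⟩ := hN p q hqp.symm
      obtain ⟨r, hr, hrw⟩ := hw.top_left
      obtain ⟨r', hr', hrw'⟩ := hw.top_right
      have hle : leadExp (g p) ⊔ leadExp (g q) ≤ e :=
        sup_le (leadExp_le_of_isTop hp (hV p)) (leadExp_le_of_isTop hq (hV q))
      -- The factor $c_p/r$ makes the top coefficient at $p$ cancel when this multiple of $w$ is
      -- subtracted; the value of the sum is unchanged.
      have hw0 : ∑ k, (((c p / r) • mono (e - leadExp (g p) ⊔ leadExp (g q))) • w) k * g k = 0 := by
        rw [sum_smul_mul, hw.sum_eq_zero, mul_zero]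
      have hwtop : ∀ {k : ι} {a : ℂ}, IsTop (w k * g k) (leadExp (g p) ⊔ leadExp (g q)) a →
          IsTop ((V - ((c p / r) • mono (e - leadExp (g p) ⊔ leadExp (g q))) • w) k * g k) e
            (c k - c p / r * a) := by
        intro k a ha
        have := (hV k).sub ((ha.mono_mul hle).smul (c p / r))
        simpa [sub_mul, mul_assoc] using this
      have hrest : ∀ k, ∃ a, IsTop (w k * g k) (leadExp (g p) ⊔ leadExp (g q)) a
          ∧ (k ≠ q → c k = 0 → a = 0) ∧ (k = p → a = r) := by
        intro k
        by_cases hkp : k = p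
        · subst hkp
          exact ⟨r, hrw, fun _ h0 => absurd h0 hp, fun _ => rfl⟩
        by_cases hkq : k = q
        · subst hkq
          exact ⟨r', hrw', fun h0 => absurd rfl h0, fun h0 => absurd h0 hkp⟩
        · exact ⟨0, hw.low k hkp hkq, fun _ _ => rfl, fun h0 => absurd h0 hkp⟩
      choose a ha ha' hap using hrest
      -- The index $p$ drops out of the set of nonzero coefficients. The only other coefficient that
      -- changes is at $q$, which already belonged to that set.
      obtain ⟨V', hV'N, hV'⟩ := ihn _ _ (fun k => hwtop (ha k)) (by
        refine Nat.le_of_lt_succ (lt_of_lt_of_le (Set.ncard_lt_ncard ?_ (Set.toFinite _)) hn)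
        refine (Set.ssubset_iff_of_subset ?_).2 ⟨p, hp, ?_⟩
        · intro k hk hck
          by_cases hkq : k = q
          · exact hq (hkq ▸ hck)
          · exact hk (by simp [hck, ha' k hkq hck])
        · simp [hap p rfl, div_mul_cancel₀ _ hr])
      refine ⟨V', ?_, fun k => ?_⟩
      · have := add_mem hV'N
          (N.smul_mem ((c p / r) • mono (e - leadExp (g p) ⊔ leadExp (g q))) hwN)
        rwa [sub_right_comm, sub_add_cancel] at this
      · have := hV' k
        rwa [sum_sub_mul, hw0, sub_zero] at this
    · refine ⟨V, by simp, fun k => ?_⟩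
      rw [hsum.leadKey_eq hz]
      exact leadKey_le_iff.2 ⟨_, hV k⟩

/-- Buchberger's and Schreyer's reduction: modulo a module of relations that contains a critical
relation for each pair, every combination of the `g_k` has a representative without terms above
the leading monomial of its value. -/
theorem exists_reduced {N : Submodule (HWeyl m) (ι → HWeyl m)}
    (hN : ∀ p q, p ≠ q → ∃ w ∈ N, IsCritical g p q w) (V : ι → HWeyl m) :
    ∃ V' : ι → HWeyl m, V - V' ∈ N ∧
      ∀ k, leadKey (V' k * g k) ≤ leadKey (∑ k, V k * g k) := by
  by_cases h0 : ∀ k, V k * g k = 0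
  · exact ⟨V, by simp, fun k => by simp [h0, leadKey_zero]⟩
  push Not at h0
  obtain ⟨k₁, hk₁⟩ := h0
  obtain ⟨k₀, -, hmax⟩ := Finset.exists_max_image Finset.univ (fun k => leadKey (V k * g k))
    ⟨k₁, Finset.mem_univ k₁⟩
  have hk₀ : V k₀ * g k₀ ≠ 0 := fun h0 => by
    have := hmax k₁ (Finset.mem_univ _)
    rw [h0, leadKey_zero, le_bot_iff, leadKey_eq_bot_iff] at this
    exact hk₁ this
  obtain ⟨hcoeff, htop⟩ := isTop_lead hk₀
  have hle : ∀ k, ∃ c, IsTop (V k * g k) (leadExp (V k₀ * g k₀)) c := fun k =>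
    leadKey_le_iff.1 ((hmax k (Finset.mem_univ k)).trans (htop.leadKey_eq hcoeff).le)
  choose c' hc' using hle
  exact exists_reduced_aux hN _ _ V c' hc' le_rfl

/-- A reduced representative of a relation has summands bounded by the leading key of 0, which is
`⊥`. They all vanish, and with $g_k\neq0$ and no zero divisors so does the representative. -/
theorem mem_of_sum_eq_zero {N : Submodule (HWeyl m) (ι → HWeyl m)} (hg : ∀ k, g k ≠ 0)
    (hN : ∀ p q, p ≠ q → ∃ w ∈ N, IsCritical g p q w) {V : ι → HWeyl m}
    (hV : ∑ k, V k * g k = 0) : V ∈ N := by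
  obtain ⟨V', hV'N, hV'⟩ := exists_reduced hN V
  have : V' = 0 := by
    ext k
    have := hV' k
    rw [hV, leadKey_zero, le_bot_iff, leadKey_eq_bot_iff] at this
    exact (mul_eq_zero.1 this).resolve_right (hg k)
  simpa [this] using hV'N

theorem isTop_sMult_mul {f g : HWeyl m} (hf : f ≠ 0) :
    IsTop (sMult f g * f) (leadExp f ⊔ leadExp g) (leadCoeff g * leadCoeff f) := by
  rw [sMult, smul_mul_assoc]
  exact ((isTop_lead hf).2.mono_mul le_sup_left).smul _

/-- Both products have the same coefficient at the least common multiple, namely the product of the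
two leading coefficients. -/
theorem isTop_sPair {f g : HWeyl m} (hf : f ≠ 0) (hg : g ≠ 0) :
    IsTop (sPair f g) (leadExp f ⊔ leadExp g) 0 := by
  have := (isTop_sMult_mul (g := g) hf).sub (sup_comm (leadExp g) _ ▸ isTop_sMult_mul (g := f) hg)
  rwa [mul_comm (leadCoeff f), sub_self] at this

/-- The vector of the two S-pair multipliers has the S-pair as its value; its reduced representative
is the desired standard representation. -/
theorem exists_isStandardRep_sPair [DecidableEq ι] {N : Submodule (HWeyl m) (ι → HWeyl m)}
    (hN : ∀ p q, p ≠ q → ∃ w ∈ N, IsCritical g p q w) (hN0 : ∀ w ∈ N, ∑ k, w k * g k = 0)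
    (p q : ι) : ∃ r, IsStandardRep g (sPair (g p) (g q)) r := by
  have hsum : ∑ k, (Pi.single p (sMult (g p) (g q)) - Pi.single q (sMult (g q) (g p)) :
      ι → HWeyl m) k * g k = sPair (g p) (g q) := by
    simp [sub_mul, Finset.sum_sub_distrib, Pi.single_apply, sPair]
  obtain ⟨r, hrN, hr⟩ := exists_reduced hN
    (Pi.single p (sMult (g p) (g q)) - Pi.single q (sMult (g q) (g p)))
  rw [hsum] at hr
  have := hN0 _ hrN
  rw [sum_sub_mul, hsum, sub_eq_zero] at this
  exact ⟨r, this, fun k _ => hr k⟩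

variable [DecidableEq ι]

theorem sum_sPairRelation_mul {r : ι → HWeyl m}
    (hr : IsStandardRep g (sPair (g p) (g q)) r) : ∑ k, sPairRelation g p q r k * g k = 0 := by
  have h1 := hr.1
  simp only [sPairRelation, Pi.sub_apply, sub_mul, Finset.sum_sub_distrib, ← h1, sPair]
  simp [Pi.single_apply]

/-- The S-pair lies strictly below the least common multiple, hence so does each summand of a
standard representation. Only the two multiplied generators reach it. -/
theorem isCritical_sPairRelation (hg : ∀ k, g k ≠ 0) (hpq : p ≠ q) {r : ι → HWeyl m}
    (hr : IsStandardRep g (sPair (g p) (g q)) r) : IsCritical g p q (sPairRelation g p q r) := by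
  have hlow : ∀ k, IsTop (r k * g k) (leadExp (g p) ⊔ leadExp (g q)) 0 := fun k => by
    by_cases h0 : r k = 0
    · rw [h0, zero_mul]
      exact IsTop.zero
    · exact leadKey_lt_iff.1 ((hr.2 k h0).trans_lt (leadKey_lt_iff.2 (isTop_sPair (hg p) (hg q))))
  have hp := (isTop_sMult_mul (g := g q) (hg p)).sub (hlow p)
  have hq := (isTop_sMult_mul (g := g p) (hg q)).neg
  rw [sup_comm] at hq
  replace hq := hq.sub (hlow q)
  rw [sub_zero] at hp hq
  refine ⟨sum_sPairRelation_mul hr, ⟨_, mul_ne_zero (isTop_lead (hg q)).1 (isTop_lead (hg p)).1, ?_⟩,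
    ⟨_, neg_ne_zero.2 (mul_ne_zero (isTop_lead (hg p)).1 (isTop_lead (hg q)).1), ?_⟩,
    fun k hkp hkq => ?_⟩
  · simpa [sPairRelation, sub_mul, Pi.single_apply, hpq] using hp
  · simpa [sPairRelation, sub_mul, Pi.single_apply, hpq.symm] using hq
  · simpa [sPairRelation, sub_mul, Pi.single_apply, hkp, hkq] using (hlow k).neg

end Reduction

end HWeyl

/-! ### The action of the Weyl algebra on polynomials -/

namespace Weyl

variable {m : ℕ}

/-- Induction over the generators of `D`. -/
theorem induction {C : Weyl m → Prop} (algebraMap : ∀ r : ℂ, C (algebraMap ℂ (Weyl m) r))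
    (x : ∀ i, C (x i)) (d : ∀ i, C (d i))
    (mul : ∀ f g, C f → C g → C (f * g)) (add : ∀ f g, C f → C g → C (f + g))
    (f : Weyl m) : C f := by
  obtain ⟨p, rfl⟩ := RingQuot.mkAlgHom_surjective ℂ (WRel m) f
  change C (mk m p)
  induction p using FreeAlgebra.induction with
  | grade0 r => rw [AlgHom.commutes]; exact algebraMap r
  | grade1 g => cases g with
    | x i => exact x i
    | d i => exact d i
  | mul a b ha hb => rw [map_mul]; exact mul _ _ ha hb
  | add a b ha hb => rw [map_add]; exact add _ _ ha hb

/-- The action of the generators of `D` on polynomials: `x_i` acts by multiplication, and `∂_i`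
acts as `ξ_i + ∂/∂x_i`. -/
noncomputable def symbolGen : WGen m → Module.End ℂ (MvPolynomial (HGen m) ℂ)
  | .x i => LinearMap.mulLeft ℂ (MvPolynomial.X (.x i))
  | .d i => LinearMap.mulLeft ℂ (MvPolynomial.X (.d i)) +
      (MvPolynomial.pderiv (R := ℂ) (HGen.x i)).toLinearMap

theorem lift_symbolGen_eq {p q : FreeAlgebra ℂ (WGen m)} (hpq : WRel m p q) :
    FreeAlgebra.lift ℂ symbolGen p = FreeAlgebra.lift ℂ symbolGen q := by
  classical
  cases hpq with
  | x_comm i j =>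
    refine LinearMap.ext fun f => ?_
    simp [symbolGen]; ring
  | d_comm i j =>
    refine LinearMap.ext fun f => ?_
    have hc := HWeyl.pderiv_comm (HGen.x i) (HGen.x j) f
    simp [symbolGen, Derivation.leibniz, MvPolynomial.pderiv_X, hc]; ring
  | d_x_ne i j hij =>
    refine LinearMap.ext fun f => ?_
    simp [symbolGen, Derivation.leibniz, MvPolynomial.pderiv_X, hij.symm]
    ring
  | d_x_eq i =>
    refine LinearMap.ext fun f => ?_
    simp [symbolGen, Derivation.leibniz, MvPolynomial.pderiv_X]
    ring

/-- The action of `D` on polynomials. -/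
noncomputable def symbolAct (m : ℕ) : Weyl m →ₐ[ℂ] Module.End ℂ (MvPolynomial (HGen m) ℂ) :=
  RingQuot.liftAlgHom ℂ ⟨FreeAlgebra.lift ℂ symbolGen, fun {_ _} hpq => lift_symbolGen_eq hpq⟩

theorem symbolAct_mk_ι (g : WGen m) :
    symbolAct m (mk m (FreeAlgebra.ι ℂ g)) = symbolGen g := by
  have := RingQuot.liftAlgHom_mkAlgHom_apply ℂ (FreeAlgebra.lift ℂ (symbolGen (m := m)))
    (fun {_ _} hpq => lift_symbolGen_eq hpq) (FreeAlgebra.ι ℂ g) (s := WRel m)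
  rw [FreeAlgebra.lift_ι_apply] at this
  exact this

theorem symbolAct_x (i : Fin m) : symbolAct m (x i) = symbolGen (.x i) := symbolAct_mk_ι _

theorem symbolAct_d (i : Fin m) : symbolAct m (d i) = symbolGen (.d i) := symbolAct_mk_ι _

end Weyl

namespace HWeyl

variable {m : ℕ}

/-! ### Dehomogenization and homogenization -/

/-- Images of the generators under dehomogenization at `τ`. -/
noncomputable def dehomAtGen (τ : ℂ) : HGen m → Weyl m
  | .h => algebraMap ℂ (Weyl m) τ
  | .x i => τ • Weyl.x i
  | .d i => τ • Weyl.d i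

/-- The homomorphism `D^(h) → D` with `h ↦ τ`, `x_i ↦ τ x_i`, `∂_i ↦ τ ∂_i`. -/
noncomputable def dehomAt (m : ℕ) (τ : ℂ) : HWeyl m →ₐ[ℂ] Weyl m :=
  lift (dehomAtGen τ) (by
    intro p q hpq
    cases hpq with
    | h_comm g => simpa [dehomAtGen] using Algebra.commutes τ _
    | x_comm i j => simp [dehomAtGen, Weyl.x_mul_x i j]
    | d_comm i j => simp [dehomAtGen, Weyl.d_mul_d i j]
    | d_x_ne i j hij => simp [dehomAtGen, Weyl.d_mul_x_ne i j hij]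
    | d_x_eq i => simp [dehomAtGen, Weyl.d_mul_x_eq i, Algebra.algebraMap_eq_smul_one,
        smul_smul, pow_two])

theorem dehomAt_h (τ : ℂ) : dehomAt m τ h = algebraMap ℂ (Weyl m) τ := lift_mk_ι _ _ _

theorem dehomAt_x (τ : ℂ) (i : Fin m) : dehomAt m τ (x i) = τ • Weyl.x i := lift_mk_ι _ _ _

theorem dehomAt_d (τ : ℂ) (i : Fin m) : dehomAt m τ (d i) = τ • Weyl.d i := lift_mk_ι _ _ _

theorem dehom_h : dehom m h = 1 := lift_mk_ι _ _ _

theorem dehom_x (i : Fin m) : dehom m (x i) = Weyl.x i := lift_mk_ι _ _ _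

theorem dehom_d (i : Fin m) : dehom m (d i) = Weyl.d i := lift_mk_ι _ _ _

theorem dehomAt_one (f : HWeyl m) : dehomAt m 1 f = dehom m f := by
  induction f using HWeyl.induction with
  | algebraMap r => simp
  | h => simp [dehomAt_h, dehom_h]
  | x i => simp [dehomAt_x, dehom_x]
  | d i => simp [dehomAt_d, dehom_d]
  | mul f g hf hg => simp [hf, hg]
  | add f g hf hg => simp [hf, hg]

/-- The substitution `h ↦ τ`, `x_i ↦ τ x_i`, `ξ_i ↦ τ ξ_i` of symbols. -/
noncomputable def rescale (m : ℕ) (τ : ℂ) :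
    MvPolynomial (HGen m) ℂ →ₐ[ℂ] MvPolynomial (HGen m) ℂ :=
  MvPolynomial.aeval fun g => match g with
    | .h => MvPolynomial.C τ
    | .x i => MvPolynomial.C τ * MvPolynomial.X (.x i)
    | .d i => MvPolynomial.C τ * MvPolynomial.X (.d i)

theorem pderiv_rescale (τ : ℂ) (i : Fin m) (p : MvPolynomial (HGen m) ℂ) :
    MvPolynomial.pderiv (HGen.x i) (rescale m τ p)
      = MvPolynomial.C τ * rescale m τ (MvPolynomial.pderiv (HGen.x i) p) := by
  classical
  induction p using MvPolynomial.induction_on with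
  | C r => simp [rescale]
  | add p q hp hq => simp only [map_add, hp, hq, mul_add]
  | mul_X p g hp =>
    rw [map_mul, Derivation.leibniz, hp, Derivation.leibniz, map_add, smul_eq_mul, smul_eq_mul,
      smul_eq_mul, smul_eq_mul, map_mul, map_mul]
    have : MvPolynomial.pderiv (HGen.x i) (rescale m τ (MvPolynomial.X g))
        = MvPolynomial.C τ * rescale m τ (MvPolynomial.pderiv (HGen.x i) (MvPolynomial.X g)) := by
      cases g with
      | h => simp [rescale, MvPolynomial.pderiv_X]
      | x j =>
        by_cases hij : i = j
        · subst hij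
          simp [rescale, MvPolynomial.pderiv_X, Derivation.leibniz]
        · simp [rescale, MvPolynomial.pderiv_X, Derivation.leibniz, Ne.symm hij]
      | d j => simp [rescale, MvPolynomial.pderiv_X, Derivation.leibniz]
    rw [this]
    ring

/-- Rescaling intertwines the two actions: in the case of $\partial_i$, the chain rule contributes
one factor $\tau$, which with the $\tau$ of $\tau\partial_i$ accounts for $h^2\mapsto\tau^2$. -/
theorem rescale_symbolAct (τ : ℂ) (f : HWeyl m) (p : MvPolynomial (HGen m) ℂ) :
    rescale m τ (symbolAct m f p) = Weyl.symbolAct m (dehomAt m τ f) (rescale m τ p) := by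
  induction f using HWeyl.induction generalizing p with
  | algebraMap r => simp [Algebra.algebraMap_eq_smul_one]
  | h =>
    simp [symbolAct_h, dehomAt_h, symbolGen, rescale, MvPolynomial.smul_eq_C_mul]
  | x i =>
    simp [symbolAct_x, dehomAt_x, symbolGen, rescale, Weyl.symbolAct_x, Weyl.symbolGen,
      MvPolynomial.smul_eq_C_mul, mul_assoc]
  | d i =>
    have := pderiv_rescale τ i p
    simp only [symbolAct_d, dehomAt_d, symbolGen, Weyl.symbolAct_d, Weyl.symbolGen, map_smul,
      LinearMap.add_apply, LinearMap.smul_apply, LinearMap.mulLeft_apply, Module.End.mul_apply,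
      map_add, map_mul, this, map_pow, Derivation.coeFn_coe]
    simp [rescale, MvPolynomial.smul_eq_C_mul]
    ring
  | mul f g hf hg => simp [hf, hg]
  | add f g hf hg => simp [hf, hg]

/-- Acting on 1 turns the hypothesis into the vanishing of every rescaled symbol, and these
determine the symbol. -/
theorem eq_zero_of_dehomAt {f : HWeyl m} (hf : ∀ τ, dehomAt m τ f = 0) : f = 0 := by
  have hr : ∀ τ, rescale m τ (symbol m f) = 0 := fun τ => by
    have := rescale_symbolAct τ f 1
    rwa [hf, map_zero, LinearMap.zero_apply] at this
  -- The factor $h$ takes care of the points with $h$-coordinate 0, where the rescaling argument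
  -- fails.
  have hmul : MvPolynomial.X .h * symbol m f = 0 := by
    refine MvPolynomial.funext fun v => ?_
    rw [map_mul, map_zero, MvPolynomial.eval_X]
    by_cases hv : v .h = 0
    · rw [hv, zero_mul]
    -- With $\tau=v_h$, evaluating the rescaled symbol at $v/v_h$ gives the value of the original
    -- symbol at $v$.
    have := congrArg (MvPolynomial.eval fun g => v g / v .h) (hr (v .h))
    rw [map_zero, rescale, MvPolynomial.aeval_def, MvPolynomial.eval_eval₂] at this
    have hid : MvPolynomial.eval v (symbol m f) = 0 := by
      rw [← this, MvPolynomial.eval, MvPolynomial.coe_eval₂Hom]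
      congr 1
      · ext r; simp
      · funext g
        cases g <;> simp [mul_div_cancel₀ _ hv]
    rw [hid, mul_zero]
  refine symbol_injective ?_
  rw [map_zero]
  exact (mul_eq_zero.1 hmul).resolve_left (MvPolynomial.X_ne_zero _)

/-- Powers of $h$ raise the degree at will. Having all large $n$ available lets the two terms of a
sum, and later all entries of a vector, share one degree. -/
theorem exists_homogenization (v : Weyl m) :
    ∃ N : ℕ, ∀ n, N ≤ n → ∃ V : HWeyl m, ∀ τ, dehomAt m τ V = τ ^ n • v := by
  induction v using Weyl.induction with
  | algebraMap r =>
    refine ⟨0, fun n _ => ⟨r • h ^ n, fun τ => ?_⟩⟩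
    rw [map_smul, map_pow, dehomAt_h, ← map_pow, Algebra.algebraMap_eq_smul_one,
      Algebra.algebraMap_eq_smul_one, smul_comm]
  | x i =>
    refine ⟨1, fun n hn => ⟨h ^ (n - 1) * x i, fun τ => ?_⟩⟩
    rw [map_mul, map_pow, dehomAt_h, dehomAt_x, ← map_pow, Algebra.algebraMap_eq_smul_one,
      smul_mul_assoc, one_mul, smul_smul, ← pow_succ, Nat.sub_add_cancel hn]
  | d i =>
    refine ⟨1, fun n hn => ⟨h ^ (n - 1) * d i, fun τ => ?_⟩⟩
    rw [map_mul, map_pow, dehomAt_h, dehomAt_d, ← map_pow, Algebra.algebraMap_eq_smul_one,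
      smul_mul_assoc, one_mul, smul_smul, ← pow_succ, Nat.sub_add_cancel hn]
  | mul u v hu hv =>
    obtain ⟨N, hN⟩ := hu
    obtain ⟨N', hN'⟩ := hv
    refine ⟨N + N', fun n hn => ?_⟩
    obtain ⟨U, hU⟩ := hN N le_rfl
    obtain ⟨V, hV⟩ := hN' (n - N) (by omega)
    refine ⟨U * V, fun τ => ?_⟩
    rw [map_mul, hU, hV, smul_mul_smul_comm, ← pow_add, Nat.add_sub_cancel' (by omega)]
  | add u v hu hv =>
    obtain ⟨N, hN⟩ := hu
    obtain ⟨N', hN'⟩ := hv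
    refine ⟨N + N', fun n hn => ?_⟩
    obtain ⟨U, hU⟩ := hN n (by omega)
    obtain ⟨V, hV⟩ := hN' n (by omega)
    exact ⟨U + V, fun τ => by rw [map_add, hU, hV, smul_add]⟩

/-! ### Dehomogenized generators of syzygies -/

theorem dehomVec_mem_span {ι : Type*} {R : Set (ι → HWeyl m)} {V : ι → HWeyl m}
    (hV : V ∈ Submodule.span (HWeyl m) R) :
    dehomVec V ∈ Submodule.span (Weyl m) (dehomVec '' R) := by
  induction hV using Submodule.span_induction with
  | mem V hV => exact Submodule.subset_span ⟨V, hV, rfl⟩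
  | zero =>
    convert Submodule.zero_mem _
    ext k
    exact map_zero (dehom m)
  | add U V _ _ hU hV =>
    convert add_mem hU hV
    ext k
    exact map_add (dehom m) _ _
  | smul f V _ hV =>
    convert Submodule.smul_mem _ (dehom m f) hV
    ext k
    exact map_mul (dehom m) _ _

/-- If `g` is homogeneous of degree `n`, and relations among the `g_k` contain critical relations
for all pairs in their span, then their dehomogenizations generate the syzygies among the
dehomogenizations of the `g_k`. -/
theorem span_dehomVec_eq_syzygies {ι : Type*} [Fintype ι] {g : ι → HWeyl m} {l : ι → Weyl m} {n : ℕ}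
    (hgl : ∀ k τ, dehomAt m τ (g k) = τ ^ n • l k) (hg : ∀ k, g k ≠ 0) {R : Set (ι → HWeyl m)}
    (hR : ∀ w ∈ R, ∑ k, w k * g k = 0)
    (hcrit : ∀ p q, p ≠ q → ∃ w ∈ Submodule.span (HWeyl m) R, IsCritical g p q w) :
    Submodule.span (Weyl m) (dehomVec '' R) = syzygies l := by
  refine le_antisymm (Submodule.span_le.2 ?_) fun v hv => ?_
  · rintro _ ⟨w, hw, rfl⟩
    change ∑ k, dehom m (w k) * l k = 0
    have := congrArg (dehom m) (hR w hw)
    rw [map_sum, map_zero] at this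
    rw [← this]
    refine Finset.sum_congr rfl fun k _ => ?_
    rw [map_mul, ← dehomAt_one (g k), hgl, one_pow, one_smul]
  · change ∑ k, v k * l k = 0 at hv
    choose N hN using fun k => exists_homogenization (v k)
    -- The sum of all thresholds serves as a common degree for the entries.
    choose V hV using fun k => hN k (∑ k, N k) (Finset.single_le_sum (by simp) (Finset.mem_univ k))
    have hVg : ∑ k, V k * g k = 0 := eq_zero_of_dehomAt fun τ => by
      simp only [map_sum, map_mul, hV, hgl, smul_mul_smul_comm]
      rw [← Finset.smul_sum, hv, smul_zero]
    have hVv : dehomVec V = v := by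
      ext k
      rw [dehomVec, ← dehomAt_one, hV, one_pow, one_smul]
    exact hVv ▸ dehomVec_mem_span (mem_of_sum_eq_zero hg hcrit hVg)

end HWeyl

open HWeyl

section Identities

variable {m : ℕ}

/-! ### Identities among the operators -/

theorem h_mul_x (i : Fin m) : (h * x i : HWeyl m) = x i * h := (h_commute _).eq

theorem h_mul_x_mul (i : Fin m) (f : HWeyl m) : h * (x i * f) = x i * (h * f) := by
  rw [← mul_assoc, h_mul_x, mul_assoc]

theorem h_mul_d (i : Fin m) : (h * d i : HWeyl m) = d i * h := (h_commute _).eq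

theorem h_mul_d_mul (i : Fin m) (f : HWeyl m) : h * (d i * f) = d i * (h * f) := by
  rw [← mul_assoc, h_mul_d, mul_assoc]

theorem x_mul_x_comm (i j : Fin m) : (x i * x j : HWeyl m) = x j * x i := (x_commute i j).eq

theorem x_mul_left_comm (i j : Fin m) (f : HWeyl m) : x i * (x j * f) = x j * (x i * f) := by
  rw [← mul_assoc, x_mul_x_comm, mul_assoc]

theorem d_mul_x_mul (i : Fin m) (f : HWeyl m) :
    d i * (x i * f) = x i * (d i * f) + h * (h * f) := by
  rw [← mul_assoc, d_mul_x, add_mul, mul_assoc, pow_two, mul_assoc]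

theorem d_mul_x_of_ne {i j : Fin m} (hij : i ≠ j) : (d i * x j : HWeyl m) = x j * d i :=
  (d_commute_x hij).eq

theorem d_mul_x_mul_of_ne {i j : Fin m} (hij : i ≠ j) (f : HWeyl m) :
    d i * (x j * f) = x j * (d i * f) := by
  rw [← mul_assoc, d_mul_x_of_ne hij, mul_assoc]

theorem theta_mul_x (i : Fin m) : (theta i * x i : HWeyl m) = x i * (theta i + h ^ 2) := by
  rw [theta, mul_assoc, d_mul_x]

theorem theta_commute_x {i j : Fin m} (hij : i ≠ j) : Commute (theta i : HWeyl m) (x j) :=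
  (x_commute i j).mul_left (d_commute_x hij)

theorem theta_commute (i j : Fin m) : Commute (theta i : HWeyl m) (theta j) := by
  by_cases hij : i = j
  · rw [hij]
  · exact (theta_commute_x hij).mul_right
      (((d_commute_x (Ne.symm hij)).symm).mul_left (d_commute i j))

theorem commute_opS {f : HWeyl m} {i : Fin m} (hf : Commute f (theta i)) (c : Fin m → ℂ) :
    Commute f (opS c i) :=
  hf.mul_right (hf.add_right ((((h_commute f).symm).pow_right 2).smul_right _))

theorem opS_commute_x {i j : Fin m} (hij : i ≠ j) (c : Fin m → ℂ) :
    Commute (opS c i) (x j) :=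
  (commute_opS (theta_commute_x hij).symm c).symm

theorem opS_commute (c : Fin m → ℂ) (i j : Fin m) : Commute (opS c i) (opS c j) :=
  commute_opS (commute_opS (theta_commute j i) c).symm c

theorem thetaSum_commute_opS (c : Fin m → ℂ) (i : Fin m) :
    Commute (thetaSum m) (opS c i) :=
  commute_opS (Commute.sum_left _ _ _ fun j _ => theta_commute j i) c

theorem thetaSum_mul_x (i : Fin m) : thetaSum m * x i = x i * (thetaSum m + h ^ 2) := by
  rw [thetaSum, ← Finset.add_sum_erase _ _ (Finset.mem_univ i), add_mul, theta_mul_x,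
    (Commute.sum_left _ _ _ fun j hj => theta_commute_x (Finset.ne_of_mem_erase hj) :
      Commute (∑ j ∈ Finset.univ.erase i, (theta j : HWeyl m)) (x i)).eq, ← mul_add]
  congr 1
  abel

theorem thetaSum_mul_opT₂ (c : Fin m → ℂ) (i j : Fin m) :
    thetaSum m * opT₂ c i j = opT₂ c i j * (thetaSum m + h ^ 2) := by
  have hS : ∀ i, opS c i * (thetaSum m + h ^ 2) = (thetaSum m + h ^ 2) * opS c i := fun i =>
    ((thetaSum_commute_opS c i).add_left ((h_commute _).pow_left 2)).eq.symm
  rw [opT₂, mul_sub, ← mul_assoc, ← mul_assoc, thetaSum_mul_x, thetaSum_mul_x, sub_mul, mul_assoc,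
    mul_assoc, mul_assoc, mul_assoc, hS, hS]

/-- The $S_i$ commute with $\theta$ and $\theta x_i=x_i(\theta+h^2)$, so moving $\theta$ past
$T_{ij}$ adds $h^2$. This is the source of the shift to $a-1$, $b-1$. -/
theorem opSab_mul_opT₂ (a b : ℂ) (c : Fin m → ℂ) (i j : Fin m) :
    opSab m (a - 1) (b - 1) * opT₂ c i j = opT₂ c i j * opSab m a b := by
  have hs : ∀ r : ℂ, (thetaSum m + (r - 1) • h ^ 2) * opT₂ c i j
      = opT₂ c i j * (thetaSum m + r • h ^ 2) := fun r => by
    rw [add_mul, thetaSum_mul_opT₂, smul_mul_assoc, ((h_commute (opT₂ c i j)).pow_left 2).eq,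
      ← mul_smul_comm, ← mul_add]
    congr 1
    module
  rw [opSab, mul_assoc, hs, ← mul_assoc, hs, mul_assoc, opSab]

/-- This links the S-pair multipliers $x_i^2\partial_i^2$ to the operators $S_i$, for which the
identities take the form of identities of minors. -/
theorem opS_eq (c : Fin m → ℂ) (i : Fin m) :
    opS c i = x i ^ 2 * d i ^ 2 + c i • (h ^ 2 * theta i) := by
  simp only [opS, theta, pow_two, mul_add, mul_smul_comm, mul_assoc, d_mul_x_mul, h_mul_x_mul,
    h_mul_d, h_mul_d_mul]
  module

theorem x_sq_mul_d_sq (c : Fin m → ℂ) (i : Fin m) :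
    (x i ^ 2 * d i ^ 2 : HWeyl m) = opS c i - c i • (h ^ 2 * theta i) := by
  rw [opS_eq, add_sub_cancel_right]

theorem x_sq_mul_x_mul_d_sq (c : Fin m → ℂ) (i j : Fin m) :
    (x i ^ 2 * x j * d i ^ 2 : HWeyl m) = x j * opS c i - c i • (h ^ 2 * x j * theta i) := by
  rw [((x_commute i j).pow_left 2).eq, mul_assoc, x_sq_mul_d_sq c, mul_sub, mul_smul_comm,
    ← mul_assoc (x j), ((h_commute (x j)).pow_left 2).eq]

theorem opT₂_self (c : Fin m → ℂ) (i : Fin m) : opT₂ c i i = 0 := sub_self _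

theorem opT₂_swap (c : Fin m → ℂ) (i j : Fin m) : opT₂ c j i = -opT₂ c i j := by
  simp [opT₂]

theorem h_mul_opT₂ (a b : ℂ) (c : Fin m → ℂ) (i j : Fin m) :
    h * opT₂ c i j = x j * opT a b c i - x i * opT a b c j := by
  simp only [opT₂, opT, mul_sub, h_mul_x_mul, x_mul_left_comm i j]
  abel

/-- Expansion of a vanishing $3\times3$ determinant with two rows $x$ and one row $S$. The operators
$S$ stay on the right, so the indices may coincide. -/
theorem x_mul_opT₂ (c : Fin m → ℂ) (i j k : Fin m) :
    x k * opT₂ c i j = x j * opT₂ c i k - x i * opT₂ c j k := by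
  simp only [opT₂, mul_sub, x_mul_left_comm j i, x_mul_left_comm k i, x_mul_left_comm k j]
  abel

/-- The terms $hS_jS_i$ cancel on the right, leaving $T_{ij}S_{a,b}$, and $S_{a,b}$ is then moved to
the left. -/
theorem opS_mul_opT_sub (a b : ℂ) (c : Fin m → ℂ) {i j : Fin m} (hij : i ≠ j) :
    opSab m (a - 1) (b - 1) * opT₂ c i j = opS c j * opT a b c i - opS c i * opT a b c j := by
  rw [opSab_mul_opT₂]
  simp only [opT₂, opT, mul_sub, sub_mul, ← mul_assoc, (opS_commute_x hij c).eq,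
    (opS_commute_x hij.symm c).eq, (h_commute (opS c _)).eq.symm]
  rw [mul_assoc h, mul_assoc h, (opS_commute c i j).eq]
  abel

/-- The companion of `x_mul_opT₂` with row $S$ repeated. Here the indices must differ, because $S_k$
commutes with $x_i$ only for $i\neq k$. -/
theorem opS_mul_opT₂ (c : Fin m → ℂ) {i j k : Fin m} (hij : i ≠ j) (hik : i ≠ k) (hjk : j ≠ k) :
    opS c k * opT₂ c i j = opS c i * opT₂ c k j + opS c j * opT₂ c i k := by
  simp only [opT₂, mul_sub, ← mul_assoc, (opS_commute_x hij c).eq, (opS_commute_x hij.symm c).eq,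
    (opS_commute_x hik c).eq, (opS_commute_x hik.symm c).eq, (opS_commute_x hjk c).eq,
    (opS_commute_x hjk.symm c).eq]
  simp only [mul_assoc, (opS_commute c i j).eq, (opS_commute c i k).eq, (opS_commute c j k).eq]
  abel

/-- Evaluation of a vector of coefficients at the family `G`. -/
noncomputable def evalG (a b : ℂ) (c : Fin m → ℂ) : (Idx m → HWeyl m) →ₗ[HWeyl m] HWeyl m :=
  Fintype.linearCombination (HWeyl m) (opG a b c)

theorem evalG_apply (a b : ℂ) (c : Fin m → ℂ) (w : Idx m → HWeyl m) :
    evalG a b c w = ∑ k, w k * opG a b c k := by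
  simp [evalG, Fintype.linearCombination_apply]

theorem evalG_single (a b : ℂ) (c : Fin m → ℂ) (k : Idx m) :
    evalG a b c (Pi.single k 1) = opG a b c k := by
  simp [evalG]

theorem evalG_unitT (a b : ℂ) (c : Fin m → ℂ) (i : Fin m) :
    evalG a b c (unitT i) = opT a b c i :=
  evalG_single a b c (.inl i)

theorem evalG_unitT₂ (a b : ℂ) (c : Fin m → ℂ) (i j : Fin m) :
    evalG a b c (unitT₂ i j) = opT₂ c i j := by
  rcases lt_trichotomy i j with hij | rfl | hji
  · rw [unitT₂, dif_pos hij, evalG_single, opG]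
  · simp [unitT₂, opT₂_self]
  · rw [unitT₂, dif_neg hji.asymm, dif_pos hji, map_neg, evalG_single, opG, opT₂_swap, neg_neg]

theorem ExplicitRelation.evalG_eq_zero {a b : ℂ} {c : Fin m → ℂ} {w : Idx m → HWeyl m}
    (hw : ExplicitRelation a b c w) : evalG a b c w = 0 := by
  cases hw with
  | T_T i j hij =>
    simp only [map_sub, map_smul, evalG_unitT, evalG_unitT₂, smul_eq_mul]
    rw [opS_mul_opT_sub a b c hij.ne, sub_self]
  | Ti_Tij i j hij =>
    simp only [map_sub, map_smul, evalG_unitT, evalG_unitT₂, smul_eq_mul, h_mul_opT₂ a b]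
    abel
  | Tj_Tij i j hij =>
    have h1 := h_mul_opT₂ a b c i j
    have h2 := opS_mul_opT_sub a b c hij.ne
    simp only [map_sub, map_smul, evalG_unitT, evalG_unitT₂, smul_eq_mul, sub_mul, h2,
      x_sq_mul_d_sq c i]
    rw [opS_eq c j]
    -- Each $T_{ij}$ carries a factor $h$ or $S_{a-1,b-1}$ and can be eliminated in favour of $T_i$
    -- and $T_j$. What remains is normal ordering of their coefficients.
    generalize opT a b c i = Ti at *
    generalize opT a b c j = Tj at *
    simp only [theta, pow_succ, pow_zero, one_mul, mul_add, add_mul, sub_mul, mul_sub,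
      smul_mul_assoc, mul_smul_comm, mul_assoc, h_mul_x_mul, h_mul_d_mul, h1, d_mul_x_mul,
      d_mul_x_mul_of_ne hij.ne', x_mul_left_comm j i, smul_sub, smul_add, sub_smul]
    module
  | Tk_Tij i j k hij hik hjk =>
    have h1 : x j * opS c i * opT a b c k - x k * opS c i * opT a b c j
        = h * (opS c i * opT₂ c k j) := by
      rw [← mul_assoc h, (h_commute _).eq, mul_assoc (opS c i), h_mul_opT₂ a b,
        ← (opS_commute_x hij.ne c).eq, ← (opS_commute_x hik c).eq, mul_sub, mul_assoc, mul_assoc]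
    have h2 : h * opS c k * opT₂ c i j
        = h * (opS c i * opT₂ c k j) + h * (opS c j * opT₂ c i k) := by
      rw [mul_assoc, opS_mul_opT₂ c hij.ne hik hjk, mul_add]
    have h3 : h * x k ^ 2 * d k ^ 2 = h * opS c k - c k • (h ^ 3 * theta k) := by
      rw [mul_assoc, x_sq_mul_d_sq c, mul_sub, mul_smul_comm, ← mul_assoc, ← pow_succ']
    simp only [map_sub, map_add, map_smul, evalG_unitT, evalG_unitT₂, smul_eq_mul,
      x_sq_mul_x_mul_d_sq c, h3, sub_mul, h2, opT₂_swap c i k, mul_neg, mul_assoc h (opS c j)]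
    rw [← sub_eq_zero] at h1
    rw [← h1]
    abel
  | Tij_Tik i j k hij hik hjk =>
    simp only [map_sub, map_smul, evalG_unitT₂, smul_eq_mul, x_mul_opT₂ c i j k]
    noncomm_ring
  | Tij_Tkj i j k hij hkj hik =>
    simp only [map_sub, map_add, map_smul, evalG_unitT₂, smul_eq_mul, x_sq_mul_d_sq c, sub_mul,
      opS_mul_opT₂ c hij.ne hik hkj.ne']
    abel
  | Tij_Tjk i j k hij hjk =>
    have h1 := x_mul_opT₂ c i j k
    have h2 := opS_mul_opT₂ c hij.ne (hij.trans hjk).ne hjk.ne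
    -- Moving $x_k$ past $\partial_j$ places it next to $T_{ij}$, which can then be replaced by
    -- terms in $T_{ik}$ and $T_{jk}$.
    have h3 : x j * x k * d j ^ 2 * opT₂ c i j = x j * d j ^ 2 * (x k * opT₂ c i j) := by
      simp only [pow_two, mul_assoc, d_mul_x_mul_of_ne hjk.ne]
    have h4 : h ^ 2 * x k * d j * opT₂ c i j = h ^ 2 * (d j * (x k * opT₂ c i j)) := by
      simp only [mul_assoc, d_mul_x_mul_of_ne hjk.ne]
    simp only [map_sub, map_add, map_smul, evalG_unitT₂, smul_eq_mul, x_sq_mul_d_sq c i, sub_mul,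
      add_mul, smul_mul_assoc, h2, h3, h4, h1, opS_eq c j, opT₂_swap c j k]
    generalize opT₂ c i k = Tik at *
    generalize opT₂ c j k = Tjk at *
    simp only [theta, pow_succ, pow_zero, one_mul, mul_sub, mul_neg, mul_assoc,
      h_mul_x_mul, h_mul_d_mul, d_mul_x_mul, mul_add, d_mul_x_mul_of_ne hij.ne', x_mul_left_comm j i]
    module
  | Tij_Tkl i j k l hij hkl hik hil hjk hjl =>
    have h1 : x l * opS c i * opT₂ c k j
        = x j * opS c i * opT₂ c k l - x k * opS c i * opT₂ c j l := by
      rw [← (opS_commute_x hil c).eq, mul_assoc, x_mul_opT₂ c k j l, mul_sub, ← mul_assoc,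
        ← mul_assoc, (opS_commute_x hij.ne c).eq, (opS_commute_x hik c).eq]
    have h2 : x l * opS c k * opT₂ c i j
        = x l * opS c i * opT₂ c k j + x l * opS c j * opT₂ c i k := by
      rw [mul_assoc, opS_mul_opT₂ c hij.ne hik hjk, mul_add, mul_assoc, mul_assoc]
    simp only [map_sub, map_add, map_smul, evalG_unitT₂, smul_eq_mul, x_sq_mul_x_mul_d_sq c,
      sub_mul, h2, h1]
    abel

end Identities

open HWeyl

section LeadingTerms

variable {m : ℕ}

/-! ### Leading terms of the operators -/

/-- The weights are compared without subtraction, so that all sums stay in `ℕ`. -/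
theorem key_lt_of_weight {e e' : HGen m →₀ ℕ}
    (hdeg : e .h + ∑ i : Fin m, e (.x i) + ∑ i : Fin m, e (.d i)
      = e' .h + ∑ i : Fin m, e' (.x i) + ∑ i : Fin m, e' (.d i))
    (hw : ∑ i : Fin m, e (.d i) + ∑ i : Fin m, e' (.x i)
      < ∑ i : Fin m, e' (.d i) + ∑ i : Fin m, e (.x i)) : key e < key e' := by
  rw [key_lt_key_iff]
  simp only [← Nat.cast_sum]
  exact Or.inr ⟨hdeg, Or.inl (by omega)⟩

theorem key_lt_of_lex {e e' : HGen m →₀ ℕ}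
    (hdeg : e .h + ∑ i : Fin m, e (.x i) + ∑ i : Fin m, e (.d i)
      = e' .h + ∑ i : Fin m, e' (.x i) + ∑ i : Fin m, e' (.d i))
    (hw : ∑ i : Fin m, e (.d i) + ∑ i : Fin m, e' (.x i)
      = ∑ i : Fin m, e' (.d i) + ∑ i : Fin m, e (.x i)) (i : Fin m)
    (hlt : ∀ j < i, e (.d j) = e' (.d j)) (hi : e (.d i) < e' (.d i)) : key e < key e' := by
  rw [key_lt_key_iff]
  simp only [← Nat.cast_sum]
  refine Or.inr ⟨hdeg, Or.inr ⟨by omega, ?_⟩⟩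
  rw [Prod.Lex.lt_iff]
  exact Or.inl ⟨i, hlt, hi⟩

theorem isTop_h : IsTop (h : HWeyl m) (Finsupp.single .h 1) 1 := by
  have := h_mul_mono (0 : HGen m →₀ ℕ)
  rw [mono_zero, mul_one, add_zero] at this
  exact this ▸ isTop_mono _

theorem isTop_x (i : Fin m) : IsTop (x i) (Finsupp.single (.x i) 1) 1 := by
  have := x_mul_mono i 0
  rw [mono_zero, mul_one, add_zero] at this
  exact this ▸ isTop_mono _

theorem isTop_d (i : Fin m) : IsTop (d i) (Finsupp.single (.d i) 1) 1 := by
  have := d_mul_mono i 0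
  rw [mono_zero, mul_one, add_zero, Finsupp.zero_apply, Nat.cast_zero, zero_smul, add_zero] at this
  exact this ▸ isTop_mono _

theorem isTop_h_sq : IsTop (h ^ 2 : HWeyl m) (Finsupp.single .h 2) 1 := by
  have := (isTop_h (m := m)).mul isTop_h
  rwa [← Finsupp.single_add, mul_one, ← pow_two] at this

theorem isTop_theta (i : Fin m) :
    IsTop (theta i) (Finsupp.single (.x i) 1 + Finsupp.single (.d i) 1) 1 := by
  simpa [theta] using (isTop_x i).mul (isTop_d i)

theorem isTop_h_sq_theta (i : Fin m) :
    IsTop (h ^ 2 : HWeyl m) (Finsupp.single (.x i) 1 + Finsupp.single (.d i) 1) 0 := by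
  classical
  refine isTop_h_sq.of_lt (key_lt_of_lex ?_ ?_ i (fun j hj => ?_) ?_)
  · simp [Finsupp.single_apply]
  · simp [Finsupp.single_apply]
  · simp [hj.ne']
  · simp

theorem isTop_opS (c : Fin m → ℂ) (i : Fin m) :
    IsTop (opS c i) (Finsupp.single (.x i) 2 + Finsupp.single (.d i) 2) 1 := by
  have := (isTop_theta i).mul ((isTop_theta i).add ((isTop_h_sq_theta i).smul (c i - 1)))
  rw [add_add_add_comm, ← Finsupp.single_add, ← Finsupp.single_add] at this
  simpa [opS] using this

/-- All $x_j\partial_j$ have equal degree and weight; the lexicographic order favours the smallest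
index. -/
theorem isTop_thetaSum (i : Fin m) (hi : ∀ j, i ≤ j) :
    IsTop (thetaSum m) (Finsupp.single (.x i) 1 + Finsupp.single (.d i) 1) 1 := by
  classical
  have : ∀ j ∈ Finset.univ, IsTop (theta j) (Finsupp.single (HGen.x i) 1 + Finsupp.single (.d i) 1)
      (if j = i then 1 else 0) := by
    intro j _
    by_cases hij : j = i
    · rw [if_pos hij, hij]
      exact isTop_theta i
    · rw [if_neg hij]
      refine (isTop_theta j).of_lt (key_lt_of_lex ?_ ?_ i (fun k hk => ?_) ?_)
      · simp [Finsupp.single_apply]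
      · simp [Finsupp.single_apply]
      · exact absurd (hi k) (not_le.2 hk)
      · simp [hij]
  simpa [thetaSum] using IsTop.sum this

theorem isTop_opSab (i : Fin m) (hi : ∀ j, i ≤ j) (a b : ℂ) :
    IsTop (opSab m a b) (Finsupp.single (.x i) 2 + Finsupp.single (.d i) 2) 1 := by
  have h1 : ∀ r : ℂ, IsTop (thetaSum m + r • h ^ 2)
      (Finsupp.single (.x i) 1 + Finsupp.single (.d i) 1) 1 := fun r => by
    simpa using (isTop_thetaSum i hi).add ((isTop_h_sq_theta i).smul r)
  have := (h1 a).mul (h1 b)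
  rwa [add_add_add_comm, ← Finsupp.single_add, ← Finsupp.single_add, mul_one] at this

theorem exists_forall_le (i : Fin m) : ∃ i₀ : Fin m, ∀ j, i₀ ≤ j :=
  ⟨⟨0, i.pos⟩, fun _ => Fin.le_def.2 (Nat.zero_le _)⟩

/-- Both terms have degree 5, but $hS_i$ has weight 0 and $x_iS_{a,b}$ has weight $-1$. -/
theorem isTop_opT (a b : ℂ) (c : Fin m → ℂ) (i : Fin m) :
    IsTop (opT a b c i)
      (Finsupp.single .h 1 + (Finsupp.single (.x i) 2 + Finsupp.single (.d i) 2)) 1 := by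
  classical
  obtain ⟨i₀, hi₀⟩ := exists_forall_le i
  have h1 := ((isTop_x i).mul (isTop_opSab i₀ hi₀ a b)).of_lt
    (e' := Finsupp.single .h 1 + (Finsupp.single (.x i) 2 + Finsupp.single (.d i) 2))
    (key_lt_of_weight (by simp [Finsupp.single_apply, Finset.sum_add_distrib])
      (by simp [Finsupp.single_apply, Finset.sum_add_distrib]))
  simpa [opT] using (isTop_h.mul (isTop_opS c i)).sub h1

/-- Degree and weight of the two terms agree, and $\partial_i\succ\partial_j$ decides. -/
theorem isTop_opT₂ (c : Fin m → ℂ) {i j : Fin m} (hij : i < j) :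
    IsTop (opT₂ c i j)
      (Finsupp.single (.x j) 1 + (Finsupp.single (.x i) 2 + Finsupp.single (.d i) 2)) 1 := by
  classical
  have h1 := ((isTop_x i).mul (isTop_opS c j)).of_lt
    (e' := Finsupp.single (.x j) 1 + (Finsupp.single (.x i) 2 + Finsupp.single (.d i) 2))
    (key_lt_of_lex (by simp [Finsupp.single_apply, Finset.sum_add_distrib])
      (by simp [Finsupp.single_apply, Finset.sum_add_distrib]) i
      (fun k hk => by simp [hk.ne', (hk.trans hij).ne'])
      (by simp [hij.ne']))
  simpa [opT₂] using ((isTop_x j).mul (isTop_opS c i)).sub h1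

/-- The exponent vectors of the leading monomials of the elements of `G`. -/
noncomputable def expG : Idx m → (HGen m →₀ ℕ)
  | .inl i => Finsupp.single .h 1 + (Finsupp.single (.x i) 2 + Finsupp.single (.d i) 2)
  | .inr p => Finsupp.single (.x p.1.2) 1
      + (Finsupp.single (.x p.1.1) 2 + Finsupp.single (.d p.1.1) 2)

theorem isTop_opG (a b : ℂ) (c : Fin m → ℂ) : ∀ k : Idx m, IsTop (opG a b c k) (expG k) 1
  | .inl i => isTop_opT a b c i
  | .inr p => isTop_opT₂ c p.2

theorem opG_ne_zero (a b : ℂ) (c : Fin m → ℂ) (k : Idx m) : opG a b c k ≠ 0 :=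
  (isTop_opG a b c k).ne_zero one_ne_zero

theorem leadExp_opG (a b : ℂ) (c : Fin m → ℂ) (k : Idx m) : leadExp (opG a b c k) = expG k :=
  (isTop_opG a b c k).leadExp_eq one_ne_zero

theorem leadCoeff_opG (a b : ℂ) (c : Fin m → ℂ) (k : Idx m) : leadCoeff (opG a b c k) = 1 :=
  (isTop_opG a b c k).leadCoeff_eq one_ne_zero

/-! ### Critical relations -/

/-- The multipliers need only have the right leading monomials, not be monomials; this admits $S_j$
in place of $x_j^2\partial_j^2$. -/
theorem isCritical_of_three {a b : ℂ} {c : Fin m → ℂ} {p q s : Idx m} (hpq : p ≠ q) (hps : p ≠ s)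
    (hqs : q ≠ s) {f f' f'' : HWeyl m} {e e' : HGen m →₀ ℕ}
    (hf : IsTop f e 1) (hf' : IsTop f' e' 1)
    (he : e + expG p = expG p ⊔ expG q) (he' : e' + expG q = expG p ⊔ expG q)
    (hf'' : IsTop (f'' * opG a b c s) (expG p ⊔ expG q) 0)
    (h0 : evalG a b c (f • Pi.single p 1 - f' • Pi.single q 1 - f'' • Pi.single s 1) = 0) :
    IsCritical (opG a b c) p q (f • Pi.single p 1 - f' • Pi.single q 1 - f'' • Pi.single s 1) := by
  have h1 := hf.mul (isTop_opG a b c p)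
  have h2 := (hf'.mul (isTop_opG a b c q)).neg
  rw [he, mul_one] at h1
  rw [he', mul_one] at h2
  refine ⟨evalG_apply a b c _ ▸ h0, ⟨1, one_ne_zero, ?_⟩, ⟨-1, by simp, ?_⟩, fun k hkp hkq => ?_⟩
  · rw [leadExp_opG, leadExp_opG]
    simpa [hpq, hps] using h1
  · rw [leadExp_opG, leadExp_opG]
    simpa [hpq.symm, hqs] using h2
  · rw [leadExp_opG, leadExp_opG]
    by_cases hks : k = s
    · subst hks
      simpa [hkp, hkq] using hf''.neg
    · simpa [hkp, hkq, hks] using IsTop.zero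

theorem unitT₂_of_lt {i j : Fin m} (hij : i < j) :
    unitT₂ i j = Pi.single (.inr ⟨(i, j), hij⟩) 1 := dif_pos hij

/-- The module generated by the explicit relations. -/
noncomputable def explicitModule (a b : ℂ) (c : Fin m → ℂ) :
    Submodule (HWeyl m) (Idx m → HWeyl m) :=
  Submodule.span (HWeyl m) {w | ExplicitRelation a b c w}

/-- The explicit relations generate a critical relation for `p` and `q`. -/
def HasCritical (a b : ℂ) (c : Fin m → ℂ) (p q : Idx m) : Prop :=
  ∃ w ∈ explicitModule a b c, IsCritical (opG a b c) p q w

variable {a b : ℂ} {c : Fin m → ℂ}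

theorem HasCritical.symm {p q : Idx m} (hpq : HasCritical a b c p q) : HasCritical a b c q p := by
  obtain ⟨w, hw, hc⟩ := hpq
  exact ⟨w, hw, hc.symm⟩

theorem HasCritical.chain {p q s : Idx m} (hps : HasCritical a b c p s)
    (hsq : HasCritical a b c s q) (hpq : p ≠ q) (hps' : p ≠ s) (hsq' : s ≠ q)
    (hs : expG s ≤ expG p ⊔ expG q) : HasCritical a b c p q := by
  obtain ⟨w, hw, hc⟩ := hps
  obtain ⟨w', hw', hc'⟩ := hsq
  obtain ⟨f, f', hff⟩ := hc.chain hc' hpq hps' hsq' (by simpa only [leadExp_opG] using hs)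
  exact ⟨_, sub_mem (Submodule.smul_mem _ f hw) (Submodule.smul_mem _ f' hw'), hff⟩

theorem HasCritical.of_explicit {p q : Idx m} {w : Idx m → HWeyl m}
    (hw : ExplicitRelation a b c w) (hc : IsCritical (opG a b c) p q w) : HasCritical a b c p q :=
  ⟨w, Submodule.subset_span hw, hc⟩

/-- The third term $S_{a-1,b-1}T_{ij}$ has weight $-1$, below the weight 0 of the least common
multiple. -/
theorem hasCritical_T_T {i j : Fin m} (hij : i < j) : HasCritical a b c (.inl i) (.inl j) := by
  classical
  obtain ⟨i₀, hi₀⟩ := exists_forall_le i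
  have hw := ExplicitRelation.T_T (a := a) (b := b) (c := c) i j hij
  refine .of_explicit hw ?_
  have h0 := hw.evalG_eq_zero
  rw [unitT₂_of_lt hij, unitT, unitT] at h0 ⊢
  refine isCritical_of_three (by simp [hij.ne]) (by simp) (by simp) (isTop_opS c j) (isTop_opS c i)
    ?_ ?_ ?_ h0
  · ext g
    cases g <;> simp [expG, Finsupp.single_apply] <;> grind
  · ext g
    cases g <;> simp [expG, Finsupp.single_apply] <;> grind
  · have he : expG (.inl i) ⊔ expG (.inl j) = Finsupp.single (.x j) 2 + Finsupp.single (.d j) 2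
        + expG (.inl i) := by
      ext g
      cases g <;> simp [expG, Finsupp.single_apply] <;> grind
    rw [he]
    refine ((isTop_opSab i₀ hi₀ _ _).mul (isTop_opG a b c _)).of_lt (key_lt_of_weight ?_ ?_)
    · simp [expG, Finsupp.single_apply, Finset.sum_add_distrib]
    · simp [expG, Finsupp.single_apply, Finset.sum_add_distrib]

theorem hasCritical_Ti_Tij {i j : Fin m} (hij : i < j) :
    HasCritical a b c (.inl i) (.inr ⟨(i, j), hij⟩) := by
  classical
  have hw := ExplicitRelation.Ti_Tij (a := a) (b := b) (c := c) i j hij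
  refine .of_explicit hw ?_
  have h0 := hw.evalG_eq_zero
  rw [unitT₂_of_lt hij, unitT, unitT] at h0 ⊢
  refine isCritical_of_three (by simp) (by simp [hij.ne]) (by simp) (isTop_x j) isTop_h
    ?_ ?_ ?_ h0
  · ext g
    cases g <;> simp [expG, Finsupp.single_apply]
  · ext g
    cases g <;> simp [expG, Finsupp.single_apply]
  · have he : expG (.inl i) ⊔ expG (.inr ⟨(i, j), hij⟩)
        = Finsupp.single (.x j) 1 + expG (.inl i) := by
      ext g
      cases g <;> simp [expG, Finsupp.single_apply]
    rw [he]
    refine ((isTop_x i).mul (isTop_opG a b c _)).of_lt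
      (key_lt_of_lex ?_ ?_ i (fun k hk => ?_) ?_)
    · simp [expG, Finsupp.single_apply, Finset.sum_add_distrib]
    · simp [expG, Finsupp.single_apply, Finset.sum_add_distrib]
    · simp [expG, hk.ne', (hk.trans hij).ne']
    · simp [expG, hij.ne']

theorem hasCritical_Tij_Tik {i j k : Fin m} (hij : i < j) (hjk : j < k) :
    HasCritical a b c (.inr ⟨(i, j), hij⟩) (.inr ⟨(i, k), hij.trans hjk⟩) := by
  classical
  have hw := ExplicitRelation.Tij_Tik (a := a) (b := b) (c := c) i j k hij (hij.trans hjk) hjk.ne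
  refine .of_explicit hw ?_
  have h0 := hw.evalG_eq_zero
  rw [unitT₂_of_lt hij, unitT₂_of_lt hjk, unitT₂_of_lt (hij.trans hjk)] at h0 ⊢
  refine isCritical_of_three (by simp [hjk.ne]) (by simp [hij.ne]) (by simp [hij.ne]) (isTop_x k)
    (isTop_x j) ?_ ?_ ?_ h0
  · ext g
    cases g <;> simp [expG, Finsupp.single_apply] <;> grind
  · ext g
    cases g <;> simp [expG, Finsupp.single_apply] <;> grind
  · have he : expG (.inr ⟨(i, j), hij⟩) ⊔ expG (.inr ⟨(i, k), hij.trans hjk⟩)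
        = Finsupp.single (.x k) 1 + expG (.inr ⟨(i, j), hij⟩) := by
      ext g
      cases g <;> simp [expG, Finsupp.single_apply] <;> grind
    rw [he]
    refine ((isTop_x i).neg.mul (isTop_opG a b c _)).of_lt
      (key_lt_of_lex ?_ ?_ i (fun l hl => ?_) ?_)
    · simp [expG, Finsupp.single_apply, Finset.sum_add_distrib]
    · simp [expG, Finsupp.single_apply, Finset.sum_add_distrib]
    · simp [expG, hl.ne', (hl.trans hij).ne']
    · simp [expG, hij.ne']

theorem hasCritical_Tij_Tkj {i j k : Fin m} (hik : i < k) (hkj : k < j) :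
    HasCritical a b c (.inr ⟨(i, j), hik.trans hkj⟩) (.inr ⟨(k, j), hkj⟩) := by
  classical
  have hij := hik.trans hkj
  have hw := ExplicitRelation.Tij_Tkj (a := a) (b := b) (c := c) i j k hij hkj hik.ne
  refine .of_explicit hw ?_
  have h0 := hw.evalG_eq_zero
  -- The $c$-terms turn both multipliers into $S_k$ and $S_i$, leaving a relation with three terms.
  have he : (x k ^ 2 * d k ^ 2) • unitT₂ i j - (x i ^ 2 * d i ^ 2) • unitT₂ k j
        - (opS c j • unitT₂ i k - (c k • (h ^ 2 * theta k)) • unitT₂ i j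
          + (c i • (h ^ 2 * theta i)) • unitT₂ k j)
      = opS c k • unitT₂ i j - opS c i • unitT₂ k j - opS c j • unitT₂ i k := by
    rw [x_sq_mul_d_sq c, x_sq_mul_d_sq c, sub_smul, sub_smul]
    abel
  rw [he, unitT₂_of_lt hij, unitT₂_of_lt hik, unitT₂_of_lt hkj] at h0
  rw [he, unitT₂_of_lt hij, unitT₂_of_lt hik, unitT₂_of_lt hkj]
  refine isCritical_of_three (by simp [hik.ne]) (by simp [hkj.ne']) (by simp [hik.ne'])
    (isTop_opS c k) (isTop_opS c i) ?_ ?_ ?_ h0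
  · ext g
    cases g <;> simp [expG, Finsupp.single_apply] <;> grind
  · ext g
    cases g <;> simp [expG, Finsupp.single_apply] <;> grind
  · have he : expG (.inr ⟨(i, j), hij⟩) ⊔ expG (.inr ⟨(k, j), hkj⟩)
        = Finsupp.single (.x k) 2 + Finsupp.single (.d k) 2 + expG (.inr ⟨(i, j), hij⟩) := by
      ext g
      cases g <;> simp [expG, Finsupp.single_apply] <;> grind
    rw [he]
    refine ((isTop_opS c j).mul (isTop_opG a b c _)).of_lt
      (key_lt_of_lex ?_ ?_ k (fun l hl => ?_) ?_)
    · simp [expG, Finsupp.single_apply, Finset.sum_add_distrib]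
    · simp [expG, Finsupp.single_apply, Finset.sum_add_distrib]
    · simp [expG, hl.ne', (hl.trans hkj).ne']
    · simp [expG, hik.ne, hkj.ne']

/-- The chain runs through $T_i$: the leading monomial $hx_i^2\partial_i^2$ divides the least common
multiple, with $h$ coming from $T_k$ and $x_i^2\partial_i^2$ from $T_{ij}$. -/
theorem hasCritical_T_Tij {i j k : Fin m} (hij : i < j) :
    HasCritical a b c (.inl k) (.inr ⟨(i, j), hij⟩) := by
  classical
  by_cases hki : k = i
  · subst hki
    exact hasCritical_Ti_Tij hij
  refine HasCritical.chain (s := .inl i) ?_ (hasCritical_Ti_Tij hij) (by simp) (by simp [hki])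
    (by simp) ?_
  · rcases lt_or_gt_of_ne hki with hlt | hlt
    · exact hasCritical_T_T hlt
    · exact (hasCritical_T_T hlt).symm
  · intro g
    cases g <;> simp [expG, Finsupp.single_apply]

theorem hasCritical_same_left {i j k : Fin m} (hij : i < j) (hik : i < k) (hjk : j ≠ k) :
    HasCritical a b c (.inr ⟨(i, j), hij⟩) (.inr ⟨(i, k), hik⟩) := by
  rcases lt_or_gt_of_ne hjk with hlt | hlt
  · exact hasCritical_Tij_Tik hij hlt
  · exact (hasCritical_Tij_Tik hik hlt).symm

theorem hasCritical_same_right {i j k : Fin m} (hij : i < j) (hkj : k < j) (hik : i ≠ k) :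
    HasCritical a b c (.inr ⟨(i, j), hij⟩) (.inr ⟨(k, j), hkj⟩) := by
  rcases lt_or_gt_of_ne hik with hlt | hlt
  · exact hasCritical_Tij_Tkj hlt hkj
  · exact (hasCritical_Tij_Tkj hlt hij).symm

/-- When both indices differ, the chain runs through $T_{il}$ if $i<l$. Otherwise $k<l\le i<j$, and
it runs through $T_{kj}$. In each case the square factor comes from one element and the linear one
from the other. -/
theorem hasCritical_Tij_Tkl {i j k l : Fin m} (hij : i < j) (hkl : k < l)
    (hne : (i, j) ≠ (k, l)) :
    HasCritical a b c (.inr ⟨(i, j), hij⟩) (.inr ⟨(k, l), hkl⟩) := by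
  classical
  by_cases hik : i = k
  · subst hik
    exact hasCritical_same_left hij hkl fun hjl => hne (by rw [hjl])
  by_cases hjl : j = l
  · subst hjl
    exact hasCritical_same_right hij hkl hik
  by_cases hil : i < l
  · refine HasCritical.chain (s := .inr ⟨(i, l), hil⟩) (hasCritical_same_left hij hil hjl)
      (hasCritical_same_right hil hkl hik) (by simp [hik]) (by simp [hjl]) (by simp [hik]) ?_
    intro g
    cases g <;> simp [expG, Finsupp.single_apply] <;> grind
  · have hkj : k < j := hkl.trans ((not_lt.1 hil).trans_lt hij)
    refine HasCritical.chain (s := .inr ⟨(k, j), hkj⟩) (hasCritical_same_right hij hkj hik)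
      (hasCritical_same_left hkj hkl hjl) (by simp [hik]) (by simp [hik]) (by simp [hjl]) ?_
    intro g
    cases g <;> simp [expG, Finsupp.single_apply] <;> grind

theorem hasCritical : ∀ p q : Idx m, p ≠ q → HasCritical a b c p q
  | .inl i, .inl j, hpq => by
    rcases lt_or_gt_of_ne (fun hij => hpq (by rw [hij]) : i ≠ j) with hlt | hlt
    · exact hasCritical_T_T hlt
    · exact (hasCritical_T_T hlt).symm
  | .inl _, .inr p, _ => hasCritical_T_Tij p.2
  | .inr p, .inl _, _ => (hasCritical_T_Tij p.2).symm
  | .inr p, .inr q, hpq =>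
    hasCritical_Tij_Tkl p.2 q.2 fun he => hpq (congrArg Sum.inr (Subtype.ext he))

theorem sum_mul_opG_eq_zero {w : Idx m → HWeyl m} (hw : w ∈ explicitModule a b c) :
    ∑ k, w k * opG a b c k = 0 := by
  have : explicitModule a b c ≤ LinearMap.ker (evalG a b c) :=
    Submodule.span_le.2 fun w hw => hw.evalG_eq_zero
  rw [← evalG_apply]
  exact this hw

/-! ### Dehomogenization of the operators -/

theorem dehomAt_theta (τ : ℂ) (i : Fin m) : dehomAt m τ (theta i) = τ ^ 2 • Weyl.theta i := by
  rw [theta, map_mul, dehomAt_x, dehomAt_d, smul_mul_smul_comm, Weyl.theta, pow_two]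

theorem dehomAt_h_sq (τ r : ℂ) :
    dehomAt m τ (r • h ^ 2) = τ ^ 2 • algebraMap ℂ (Weyl m) r := by
  rw [map_smul, map_pow, dehomAt_h, ← map_pow, Algebra.algebraMap_eq_smul_one,
    Algebra.algebraMap_eq_smul_one, smul_comm]

theorem dehomAt_opS (τ : ℂ) (c : Fin m → ℂ) (i : Fin m) : dehomAt m τ (opS c i)
    = τ ^ 4 • (Weyl.theta i * (Weyl.theta i + algebraMap ℂ (Weyl m) (c i - 1))) := by
  rw [opS, map_mul, map_add, dehomAt_theta, dehomAt_h_sq, ← smul_add, smul_mul_smul_comm, ← pow_add]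

theorem dehomAt_opSab (τ a b : ℂ) : dehomAt m τ (opSab m a b)
    = τ ^ 4 • ((Weyl.thetaSum m + algebraMap ℂ (Weyl m) a)
      * (Weyl.thetaSum m + algebraMap ℂ (Weyl m) b)) := by
  have hΘ : dehomAt m τ (thetaSum m) = τ ^ 2 • Weyl.thetaSum m := by
    simp only [thetaSum, map_sum, dehomAt_theta, Weyl.thetaSum, Finset.smul_sum]
  rw [opSab, map_mul, map_add, map_add, hΘ, dehomAt_h_sq, dehomAt_h_sq, ← smul_add, ← smul_add,
    smul_mul_smul_comm, ← pow_add]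

/-- The common exponent 5 is the degree of every member of $G$, as lifting syzygies requires. -/
theorem dehomAt_opG (τ : ℂ) :
    ∀ k : Idx m, dehomAt m τ (opG a b c k) = τ ^ 5 • ellFamily a b c k
  | .inl i => by
    rw [opG, opT, map_sub, map_mul, map_mul, dehomAt_h, dehomAt_x, dehomAt_opS, dehomAt_opSab,
      Algebra.algebraMap_eq_smul_one, smul_mul_smul_comm, smul_mul_smul_comm, one_mul,
      ← pow_succ', ← smul_sub, ellFamily, ell, mul_assoc (Weyl.x i)]
  | .inr p => by
    have : ∀ y : Weyl m, Weyl.x p.1.1 * (Weyl.x p.1.2 * y) = Weyl.x p.1.2 * (Weyl.x p.1.1 * y) :=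
      fun y => by rw [← mul_assoc, Weyl.x_mul_x, mul_assoc]
    rw [opG, opT₂, map_sub, map_mul, map_mul, dehomAt_x, dehomAt_x, dehomAt_opS, dehomAt_opS,
      smul_mul_smul_comm, smul_mul_smul_comm, ← pow_succ', ← smul_sub, ellFamily, ell₂, ell, ell,
      mul_sub, mul_sub, mul_assoc (Weyl.x p.1.1) (Weyl.thetaSum m + _),
      mul_assoc (Weyl.x p.1.2) (Weyl.thetaSum m + _), this]
    congr 1
    abel

/-! ### The S-pair of $T_i$ and $T_{ij}$ -/

theorem sMult_opT (a b : ℂ) (c : Fin m → ℂ) {i j : Fin m} (hij : i < j) :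
    sMult (opT a b c i) (opT₂ c i j) = x j := by
  classical
  have h1 := leadExp_opG a b c (.inl i)
  have h2 := leadExp_opG a b c (.inr ⟨(i, j), hij⟩)
  have h3 := leadCoeff_opG a b c (.inr ⟨(i, j), hij⟩)
  simp only [opG] at h1 h2 h3
  have he : expG (.inl i) ⊔ expG (.inr ⟨(i, j), hij⟩) - expG (.inl i)
      = Finsupp.single (.x j) 1 + 0 := by
    ext g
    cases g <;> simp [expG, Finsupp.single_apply]
  rw [sMult, h1, h2, h3, he, ← x_mul_mono, mono_zero, mul_one, one_smul]

theorem sMult_opT₂ (a b : ℂ) (c : Fin m → ℂ) {i j : Fin m} (hij : i < j) :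
    sMult (opT₂ c i j) (opT a b c i) = h := by
  classical
  have h1 := leadExp_opG a b c (.inl i)
  have h2 := leadExp_opG a b c (.inr ⟨(i, j), hij⟩)
  have h3 := leadCoeff_opG a b c (.inl i)
  simp only [opG] at h1 h2 h3
  have he : expG (.inr ⟨(i, j), hij⟩) ⊔ expG (.inl i) - expG (.inr ⟨(i, j), hij⟩)
      = Finsupp.single .h 1 + 0 := by
    ext g
    cases g <;> simp [expG, Finsupp.single_apply]
  rw [sMult, h1, h2, h3, he, ← h_mul_mono, mono_zero, mul_one, one_smul]

theorem sPair_opT_opT₂ (a b : ℂ) (c : Fin m → ℂ) {i j : Fin m} (hij : i < j) :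
    sPair (opT a b c i) (opT₂ c i j) = x i * opT a b c j := by
  rw [sPair, sMult_opT a b c hij, sMult_opT₂ a b c hij, h_mul_opT₂ a b, sub_sub_cancel]

theorem isStandardRep_single {ι : Type*} [Fintype ι] [DecidableEq ι] {g : ι → HWeyl m}
    {f r : HWeyl m} {k : ι} (hf : f = r * g k) : IsStandardRep g f (Pi.single k r) := by
  refine ⟨by simp [hf, Pi.single_apply], fun l hl => ?_⟩
  have hlk : l = k := by
    by_contra hne
    exact hl (Pi.single_eq_of_ne hne _)
  rw [hlk, Pi.single_eq_same, hf]

theorem dehomVec_single {ι : Type*} [DecidableEq ι] (k : ι) (f : HWeyl m) :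
    dehomVec (Pi.single k f : ι → HWeyl m) = Pi.single k (dehom m f) := by
  ext l
  by_cases hl : l = k
  · subst hl
    simp [dehomVec]
  · simp [dehomVec, hl]

theorem dehomVec_sub {ι : Type*} (v w : ι → HWeyl m) :
    dehomVec (v - w) = dehomVec v - dehomVec w := by
  ext l
  simp [dehomVec]

end LeadingTerms

end LauricellaFC

/-! ### The main theorem -/

theorem mainTheorem6 (m : ℕ) (a b : ℂ) (c : Fin m → ℂ) :
    -- Every S-pair of two members of `G` has a standard representation with respect to `G`.
    (∀ p q : LauricellaFC.Idx m, p ≠ q → ∃ r : LauricellaFC.Idx m → LauricellaFC.HWeyl m,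
      LauricellaFC.HWeyl.IsStandardRep (LauricellaFC.opG a b c)
        (LauricellaFC.HWeyl.sPair (LauricellaFC.opG a b c p) (LauricellaFC.opG a b c q)) r) ∧
    -- Whichever standard representations are chosen, one for each pair (in at least one of its two
    -- orders), the dehomogenized relations generate the syzygies.
    (∀ (P : Set (LauricellaFC.Idx m × LauricellaFC.Idx m)),
      (∀ p q, p ≠ q → (p, q) ∈ P ∨ (q, p) ∈ P) →
      ∀ r : LauricellaFC.Idx m → LauricellaFC.Idx m → LauricellaFC.Idx m → LauricellaFC.HWeyl m,
      (∀ p q, (p, q) ∈ P → LauricellaFC.HWeyl.IsStandardRep (LauricellaFC.opG a b c)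
        (LauricellaFC.HWeyl.sPair (LauricellaFC.opG a b c p) (LauricellaFC.opG a b c q))
        (r p q)) →
      Submodule.span (LauricellaFC.Weyl m)
        {v | ∃ p q, (p, q) ∈ P ∧ v = LauricellaFC.HWeyl.dehomVec
          (LauricellaFC.HWeyl.sPairRelation (LauricellaFC.opG a b c) p q (r p q))}
        = LauricellaFC.syzygies (LauricellaFC.ellFamily a b c)) ∧
    -- The dehomogenizations of the explicit relations generate the syzygies.
    Submodule.span (LauricellaFC.Weyl m)
        {v | ∃ w, LauricellaFC.ExplicitRelation a b c w ∧ v = LauricellaFC.HWeyl.dehomVec w}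
      = LauricellaFC.syzygies (LauricellaFC.ellFamily a b c) ∧
    -- The S-pair of `T_i` and `T_ij` has the standard representation `x_i T_j`, which yields the
    -- syzygy `x_j ℓ_i - ℓ_ij - x_i ℓ_j = 0`.
    (∀ (i j : Fin m) (hij : i < j),
      LauricellaFC.HWeyl.IsStandardRep (LauricellaFC.opG a b c)
        (LauricellaFC.HWeyl.sPair (LauricellaFC.opT a b c i) (LauricellaFC.opT₂ c i j))
        (Pi.single (.inl j) (LauricellaFC.HWeyl.x i)) ∧
      LauricellaFC.HWeyl.dehomVec (LauricellaFC.HWeyl.sPairRelation (LauricellaFC.opG a b c)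
          (.inl i) (.inr ⟨(i, j), hij⟩) (Pi.single (.inl j) (LauricellaFC.HWeyl.x i)))
        = (Pi.single (Sum.inl i) (LauricellaFC.Weyl.x j) :
              LauricellaFC.Idx m → LauricellaFC.Weyl m)
          - (Pi.single (Sum.inr ⟨(i, j), hij⟩) 1 : LauricellaFC.Idx m → LauricellaFC.Weyl m)
          - (Pi.single (Sum.inl j) (LauricellaFC.Weyl.x i) :
              LauricellaFC.Idx m → LauricellaFC.Weyl m) ∧
      LauricellaFC.Weyl.x j * LauricellaFC.ell a b c i - LauricellaFC.ell₂ a b c i j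
        - LauricellaFC.Weyl.x i * LauricellaFC.ell a b c j = 0) := by
  refine ⟨fun p q _ => ?_, fun P hP r hr => ?_, ?_, fun i j hij => ⟨?_, ?_, ?_⟩⟩
  · exact LauricellaFC.HWeyl.exists_isStandardRep_sPair LauricellaFC.hasCritical
      (fun w hw => LauricellaFC.sum_mul_opG_eq_zero hw) p q
  · have hset : {v | ∃ p q, (p, q) ∈ P ∧ v = LauricellaFC.HWeyl.dehomVec
          (LauricellaFC.HWeyl.sPairRelation (LauricellaFC.opG a b c) p q (r p q))}
        = LauricellaFC.HWeyl.dehomVec '' {w | ∃ p q, (p, q) ∈ P ∧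
          w = LauricellaFC.HWeyl.sPairRelation (LauricellaFC.opG a b c) p q (r p q)} := by
      ext v
      constructor
      · rintro ⟨p, q, hpq, rfl⟩
        exact ⟨_, ⟨p, q, hpq, rfl⟩, rfl⟩
      · rintro ⟨_, ⟨p, q, hpq, rfl⟩, rfl⟩
        exact ⟨p, q, hpq, rfl⟩
    rw [hset]
    refine LauricellaFC.HWeyl.span_dehomVec_eq_syzygies
      (fun k τ => LauricellaFC.dehomAt_opG τ k) (LauricellaFC.opG_ne_zero a b c) ?_ ?_
    · rintro _ ⟨p, q, hpq, rfl⟩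
      exact LauricellaFC.HWeyl.sum_sPairRelation_mul (hr p q hpq)
    · intro p q hpq
      rcases hP p q hpq with hmem | hmem
      · exact ⟨_, Submodule.subset_span ⟨p, q, hmem, rfl⟩,
          LauricellaFC.HWeyl.isCritical_sPairRelation (LauricellaFC.opG_ne_zero a b c) hpq
            (hr p q hmem)⟩
      -- Criticality is symmetric in the pair, so either order of the S-pair suffices.
      · exact ⟨_, Submodule.subset_span ⟨q, p, hmem, rfl⟩,
          (LauricellaFC.HWeyl.isCritical_sPairRelation (LauricellaFC.opG_ne_zero a b c) hpq.symm
            (hr q p hmem)).symm⟩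
  · have hset : {v | ∃ w, LauricellaFC.ExplicitRelation a b c w ∧ v = LauricellaFC.HWeyl.dehomVec w}
        = LauricellaFC.HWeyl.dehomVec '' {w | LauricellaFC.ExplicitRelation a b c w} := by
      ext v
      exact exists_congr fun w => and_congr_right fun _ => eq_comm
    rw [hset]
    exact LauricellaFC.HWeyl.span_dehomVec_eq_syzygies
      (fun k τ => LauricellaFC.dehomAt_opG τ k) (LauricellaFC.opG_ne_zero a b c)
      (fun w hw => LauricellaFC.sum_mul_opG_eq_zero (Submodule.subset_span hw))
      LauricellaFC.hasCritical
  · exact LauricellaFC.isStandardRep_single (LauricellaFC.sPair_opT_opT₂ a b c hij)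
  · rw [LauricellaFC.HWeyl.sPairRelation, LauricellaFC.dehomVec_sub, LauricellaFC.dehomVec_sub,
      LauricellaFC.dehomVec_single, LauricellaFC.dehomVec_single, LauricellaFC.dehomVec_single,
      LauricellaFC.opG, LauricellaFC.opG, LauricellaFC.sMult_opT a b c hij,
      LauricellaFC.sMult_opT₂ a b c hij, LauricellaFC.HWeyl.dehom_x, LauricellaFC.HWeyl.dehom_x,
      LauricellaFC.HWeyl.dehom_h]
  · rw [LauricellaFC.ell₂]
    abel
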